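/- For $\ell>0$ let $\mathbb T_\ell=\mathbb R/\ell\mathbb Z$ with Lebesgue measure, $\mathbb T=\mathbb T_{2\pi}$; let $L^2(\mathbb T_\ell)$, $H^1(\mathbb T_\ell)$ be the usual spaces of complex-valued functions, with $\|f\|_{H^1}^2=\|f\|_{L^2}^2+\|\partial_x f\|_{L^2}^2$. Let $p_0(z)=-z+z^3$ for $z\in\mathbb C$, and for $\varepsilon>0$ consider $$\partial_t u_1+\partial_x u_2=0,\qquad \partial_t u_2+\partial_x\big(p_0(u_1)\big)+i\varepsilon\,\partial_x^2u_2=0 .\qquad(*)$$ There exist $T>0$, $C$ and $\varepsilon_0>0$ such that the following holds for every $\varepsilon\in(0,\varepsilon_0)$, every $\ell>0$ that is an integer multiple of $2\pi\varepsilon^2$ (so that a function of $x/\varepsilon^2$ with a $2\pi$-periodic profile is a function on $\mathbb T_\ell$; the case $\ell=2\pi$ occurs exactly when $\varepsilon^{-2}$ is an integer), and all data $(u_1^0,u_2^0)\in H^1(\mathbb T)\times L^2(\mathbb T)$ with $$\int_{\mathbb T}u_1^0\,dx=\int_{\mathbb T}u_2^0\,dx=0,\qquad \max\big(\|u_1^0\|_{H^1},\|u_2^0\|_{L^2}\big)<\tfrac16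 .$$ There is a unique $u=(u_1,u_2)\in C^0\big([0,\varepsilon^2T],H^1(\mathbb T_\ell)\times L^2(\mathbb T_\ell)\big)$ that solves $(*)$ in the sense of distributions and satisfies $$u(0,x)=\Big(u_1^0\big(\tfrac{x}{\varepsilon^2}\big),\,u_2^0\big(\tfrac{x}{\varepsilon^2}\big)\Big).$$ Moreover $u$ is $O(1)$, uniformly in $\varepsilon$, $\ell$ and the data: $\|u_1(t)\|_{L^\infty(\mathbb T_\ell)}\le C$ and $\|u_2(t)\|_{L^2(\mathbb T_\ell)}\le C\sqrt{\ell}$ for all $t\in[0,\varepsilon^2T]$. -/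

import Mathlib

open MeasureTheory Set Real
open scoped ContDiff

noncomputable section

namespace SchrodingerEuler

/-- `2π > 0`, so that `AddCircle (2 * π)`, the torus `ℝ / 2πℤ`, carries its Lebesgue measure. -/
instance factTwoPiPos : Fact (0 < 2 * π) := ⟨two_pi_pos⟩

/-- `L²(ℝ/ℓℤ; ℂ)`, for the Lebesgue measure (of total mass `ℓ`) on the circle of length `ℓ`. -/
abbrev L2 (ℓ : ℝ) [Fact (0 < ℓ)] : Type := Lp ℂ 2 (volume : Measure (AddCircle ℓ))

/-- Test functions on the circle `ℝ/ℓℤ`, written as functions on the line: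
smooth and `ℓ`-periodic. -/
structure IsTest (ℓ : ℝ) (φ : ℝ → ℂ) : Prop where
  smooth : ContDiff ℝ ∞ φ
  periodic : Function.Periodic φ ℓ

/-- The (bilinear) pairing `∫₀^ℓ f φ dx` of a function on the circle with a test function. -/
def pairing {ℓ : ℝ} (f : AddCircle ℓ → ℂ) (φ : ℝ → ℂ) : ℂ :=
  ∫ x in (0 : ℝ)..ℓ, f (x : AddCircle ℓ) * φ x

/-- `g` is the derivative of `f` on the circle in the sense of distributions. -/
def HasWeakDeriv {ℓ : ℝ} [Fact (0 < ℓ)] (f g : L2 ℓ) : Prop :=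
  ∀ φ : ℝ → ℂ, IsTest ℓ φ → pairing g φ = -pairing f (deriv φ)

lemma IsTest.continuous_deriv {L : ℝ} {φ : ℝ → ℂ} (hφ : IsTest L φ) : Continuous (deriv φ) :=
  hφ.smooth.continuous_deriv (by norm_num)

section Aux

variable {ℓ : ℝ} [hℓ : Fact (0 < ℓ)]

lemma measurePreserving_coe :
    MeasurePreserving (fun x : ℝ => (x : AddCircle ℓ)) (volume.restrict (Ioc 0 ℓ)) volume := by
  simpa using AddCircle.measurePreserving_mk ℓ 0

lemma intervalIntegrable_pairing (f : L2 ℓ) {φ : ℝ → ℂ} (hφ : Continuous φ) :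
    IntervalIntegrable (fun x : ℝ => f (x : AddCircle ℓ) * φ x) volume 0 ℓ := by
  have h1 : Integrable f (volume : Measure (AddCircle ℓ)) :=
    (Lp.memLp f).integrable (by norm_num)
  have h2 : IntervalIntegrable (fun x : ℝ => f (x : AddCircle ℓ)) volume 0 ℓ := by
    rw [intervalIntegrable_iff_integrableOn_Ioc_of_le hℓ.out.le]
    exact measurePreserving_coe.integrable_comp_of_integrable h1
  exact h2.mul_continuousOn hφ.continuousOn

lemma pairing_congr {f g : AddCircle ℓ → ℂ} (h : f =ᵐ[volume] g) (φ : ℝ → ℂ) :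
    pairing f φ = pairing g φ := by
  unfold pairing
  rw [intervalIntegral.integral_of_le hℓ.out.le, intervalIntegral.integral_of_le hℓ.out.le]
  refine integral_congr_ae ?_
  filter_upwards [measurePreserving_coe.quasiMeasurePreserving.ae_eq_comp h] with x hx
  simp only [Function.comp] at hx
  rw [hx]

lemma pairing_add (f g : L2 ℓ) {φ : ℝ → ℂ} (hφ : Continuous φ) :
    pairing (f + g : L2 ℓ) φ = pairing f φ + pairing g φ := by
  rw [pairing_congr (Lp.coeFn_add f g)]
  unfold pairing
  rw [← intervalIntegral.integral_add (intervalIntegrable_pairing f hφ)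
    (intervalIntegrable_pairing g hφ)]
  simp [add_mul]

lemma pairing_smul (c : ℂ) (f : L2 ℓ) (φ : ℝ → ℂ) :
    pairing (c • f : L2 ℓ) φ = c * pairing f φ := by
  rw [pairing_congr (Lp.coeFn_smul c f)]
  unfold pairing
  rw [← intervalIntegral.integral_const_mul]
  simp [mul_assoc]

lemma pairing_zero (φ : ℝ → ℂ) : pairing (0 : L2 ℓ) φ = 0 := by
  simpa using pairing_smul (0 : ℂ) (0 : L2 ℓ) φ

end Aux

/-- The Sobolev space `H¹(ℝ/ℓℤ; ℂ)`: a function in `L²` together with its (unique) weak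
derivative in `L²`. The norm is `(‖f‖²_{L²} + ‖∂ₓ f‖²_{L²})^{1/2}`. -/
def H1 (ℓ : ℝ) [Fact (0 < ℓ)] : Submodule ℂ (WithLp 2 (L2 ℓ × L2 ℓ)) where
  carrier := {p | HasWeakDeriv p.fst p.snd}
  add_mem' := by
    intro p q hp hq φ hφ
    have h1 := pairing_add p.snd q.snd hφ.smooth.continuous
    have h2 := pairing_add p.fst q.fst hφ.continuous_deriv
    rw [WithLp.add_snd, WithLp.add_fst, h1, h2, hp φ hφ, hq φ hφ]
    ring
  zero_mem' := by
    intro φ _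
    rw [WithLp.zero_snd, WithLp.zero_fst, pairing_zero, pairing_zero, neg_zero]
  smul_mem' := by
    intro c p hp φ hφ
    rw [WithLp.smul_snd, WithLp.smul_fst, pairing_smul, pairing_smul, hp φ hφ]
    ring

/-- The function underlying an element of `H¹`. -/
def H1.toL2 {ℓ : ℝ} [Fact (0 < ℓ)] (f : H1 ℓ) : L2 ℓ := f.1.fst

/-- The pressure law `p₀(u) = -u + u³`. -/
def pressure (z : ℂ) : ℂ := -z + z ^ 3

/-- `u = (u₁, u₂) ∈ C⁰([0, τ], H¹ × L²)` solves, on the circle `ℝ/ℓℤ` and for times in `[0, τ]`,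
`∂ₜ u₁ + ∂ₓ u₂ = 0`, `∂ₜ u₂ + ∂ₓ (p₀(u₁)) + i ε ∂ₓ² u₂ = 0`.
The spatial derivatives are taken in the sense of distributions on the circle, and the time
derivative is that of the distribution-valued maps `u₁`, `u₂` (one-sided at `0` and `τ`). -/
structure IsSolution (ε τ : ℝ) {ℓ : ℝ} [Fact (0 < ℓ)] (u : ℝ → H1 ℓ × L2 ℓ) : Prop where
  continuousOn : ContinuousOn u (Icc 0 τ)
  mass : ∀ φ : ℝ → ℂ, IsTest ℓ φ → ∀ t ∈ Icc 0 τ,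
    HasDerivWithinAt (fun s => pairing (H1.toL2 (u s).1) φ)
      (pairing (u t).2 (deriv φ)) (Icc 0 τ) t
  momentum : ∀ φ : ℝ → ℂ, IsTest ℓ φ → ∀ t ∈ Icc 0 τ,
    HasDerivWithinAt (fun s => pairing (u s).2 φ)
      (pairing (fun x => pressure (H1.toL2 (u t).1 x)) (deriv φ)
        - Complex.I * ε * pairing (u t).2 (deriv (deriv φ))) (Icc 0 τ) t

/-- `u(0, x) = (a(x/ε²), b(x/ε²))` for almost every real `x`, where `a`, `b` are functions on
`ℝ/2πℤ` and `u(0)` is a pair of functions on `ℝ/ℓℤ`. -/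
def HasDatum (ε : ℝ) (a : H1 (2 * π)) (b : L2 (2 * π)) {ℓ : ℝ} [Fact (0 < ℓ)]
    (u : ℝ → H1 ℓ × L2 ℓ) : Prop :=
  (∀ᵐ x : ℝ, H1.toL2 (u 0).1 (x : AddCircle ℓ) = H1.toL2 a ((x / ε ^ 2 : ℝ) : AddCircle (2 * π))) ∧
  (∀ᵐ x : ℝ, (u 0).2 (x : AddCircle ℓ) = b ((x / ε ^ 2 : ℝ) : AddCircle (2 * π)))

end SchrodingerEuler

end

/-! The substitution `u(t / ε², x / ε²)` turns the system with dispersion `ε` on `[0, ε²T]` into the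
system with dispersion `β = 1/ε` on `[0, T]`. What is needed is therefore a well-posedness result on
the fixed circle `ℝ/2πℤ` whose existence time and bounds are uniform in `β ≥ 1`. The solution is
then pulled back along the covering `x ↦ x / ε²`.

Without dispersion the system is elliptic in time near `u₁ = 0`, and `∂ₜu₁ = -∂ₓu₂` loses a
derivative when `u₂` is only in `L²`. The dispersive term repairs this. Let `D⁻¹` be the multiplier
`1/ξ`, taken to be `0` at `ξ = 0`, and let `F(u₁) = -∂ₓ(p₀(u₁))`. At frequency `ξ` the equations
read `û₁' = -iξ û₂` and `û₂' = F̂ + iβξ² û₂`, so `u₁ + β⁻¹D⁻¹u₂` has derivative `β⁻¹D⁻¹F(u₁)`: the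
two terms `iξ û₂` cancel. Conjugating `u₂` by the unitary Schrödinger group removes the remaining
unbounded term (`IsSolution.hasDerivWithinAt_normalForm`).

Since `F : H¹ → L²` is locally Lipschitz and `D⁻¹ : L² → H¹` is bounded, the new system is an ODE in
`H¹ × L²` with a vector field that is Lipschitz on balls, uniformly in `t` and `β ≥ 1`
(`exists_lipschitzOnWith_field`). Picard-Lindelöf gives existence (`exists_isSolution`). Every
distributional solution satisfies this ODE in norm, which gives uniqueness for every `β > 0`
(`IsSolution.eqOn`), hence directly on `ℝ/ℓℤ` with dispersion `ε`. The scaling is `IsSolution.pull`.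
-/

noncomputable section

namespace SchrodingerEuler

/-! ### Fourier series on `ℝ/ℓℤ` for Lebesgue measure -/

section Fourier

open ComplexConjugate

variable {ℓ : ℝ} [hℓ : Fact (0 < ℓ)]

/-- The `k`-th frequency `2πk/ℓ` of the circle `ℝ/ℓℤ`. -/
def freq (ℓ : ℝ) (k : ℤ) : ℝ := 2 * π * k / ℓ

/-- The exponentials are orthonormal for the Haar probability measure; Lebesgue measure has total
mass `ℓ`, whence the factor `1/√ℓ`. -/
lemma orthonormal_modes :
    Orthonormal ℂ (fun k : ℤ => ContinuousMap.toLp (E := ℂ) 2 (volume : Measure (AddCircle ℓ)) ℂ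
      (((√ℓ)⁻¹ : ℂ) • fourier k)) := by
  have hs : (√ℓ : ℂ) ≠ 0 := by
    exact_mod_cast (Real.sqrt_pos.2 hℓ.out).ne'
  have hs2 : (√ℓ : ℂ) * √ℓ = ℓ := by
    exact_mod_cast Real.mul_self_sqrt hℓ.out.le
  rw [orthonormal_iff_ite]
  intro i j
  rw [ContinuousMap.inner_toLp (μ := (volume : Measure (AddCircle ℓ)))]
  have h1 := congrFun (fourierCoeff_fourier (T := ℓ) j) i
  have h2 : ∀ x : AddCircle ℓ, (((√ℓ)⁻¹ : ℂ) • fourier j) x * conj ((((√ℓ)⁻¹ : ℂ) • fourier i) x)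
      = ((ℓ : ℂ))⁻¹ * (fourier (-i) x • fourier j x) := by
    intro x
    simp only [ContinuousMap.smul_apply, smul_eq_mul, map_mul, map_inv₀, Complex.conj_ofReal,
      fourier_neg, ← hs2, mul_inv]
    ring
  simp_rw [h2]
  rw [integral_const_mul]
  have hl : (ℓ : ℂ) ≠ 0 := by exact_mod_cast hℓ.out.ne'
  rw [fourierCoeff, AddCircle.integral_haarAddCircle] at h1
  rw [← Complex.ofReal_inv, ← Complex.real_smul, h1]
  rw [Pi.single_apply]

/-- The orthonormal basis of exponentials of `L²(ℝ/ℓℤ)`, for the Lebesgue measure. -/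
def modes (ℓ : ℝ) [hℓ : Fact (0 < ℓ)] : HilbertBasis ℤ ℂ (L2 ℓ) :=
  HilbertBasis.mk orthonormal_modes (by
    have hs : (√ℓ : ℂ) ≠ 0 := by
      exact_mod_cast (Real.sqrt_pos.2 hℓ.out).ne'
    have h := (ContinuousMap.toLp_denseRange ℂ (volume : Measure (AddCircle ℓ)) ℂ
      (by norm_num : (2 : ENNReal) ≠ ⊤)).topologicalClosure_map_submodule
        (span_fourier_closure_eq_top (T := ℓ))
    rw [← h]
    refine Submodule.topologicalClosure_mono ?_
    rw [Submodule.map_span, Submodule.span_le]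
    rintro _ ⟨_, ⟨k, rfl⟩, rfl⟩
    have h3 := Submodule.smul_mem _ (√ℓ : ℂ) (Submodule.subset_span (R := ℂ) (mem_range_self (f :=
      fun k : ℤ => ContinuousMap.toLp (E := ℂ) 2 (volume : Measure (AddCircle ℓ)) ℂ
      (((√ℓ)⁻¹ : ℂ) • fourier k)) k))
    simp only [map_smul, smul_smul, mul_inv_cancel₀ hs, one_smul] at h3
    simpa using h3)

lemma modes_apply (k : ℤ) : modes ℓ k = ContinuousMap.toLp (E := ℂ) 2
    (volume : Measure (AddCircle ℓ)) ℂ (((√ℓ)⁻¹ : ℂ) • fourier k) := by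
  simp [modes, HilbertBasis.coe_mk]

/-- The `k`-th Fourier coefficient, as a continuous linear functional. -/
def coeff (k : ℤ) : L2 ℓ →L[ℂ] ℂ := innerSL ℂ (modes ℓ k)

lemma coeff_apply (k : ℤ) (f : L2 ℓ) : coeff k f = inner ℂ (modes ℓ k) f := rfl

lemma coeff_eq_repr (k : ℤ) (f : L2 ℓ) : coeff k f = (modes ℓ).repr f k := by
  rw [coeff_apply, HilbertBasis.repr_apply_apply]

lemma ext_coeff {f g : L2 ℓ} (h : ∀ k, coeff k f = coeff k g) : f = g := by
  apply (modes ℓ).repr.injective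
  ext k
  rw [← coeff_eq_repr, ← coeff_eq_repr, h]

lemma hasSum_norm_coeff_sq (f : L2 ℓ) : HasSum (fun k => ‖coeff k f‖ ^ 2) (‖f‖ ^ 2) := by
  have := lp.hasSum_norm (p := 2) (by norm_num) ((modes ℓ).repr f)
  simpa [coeff_eq_repr] using this

lemma hasSum_conj_coeff_mul (f g : L2 ℓ) :
    HasSum (fun k => conj (coeff k f) * coeff k g) (inner ℂ f g) := by
  have := (modes ℓ).hasSum_inner_mul_inner f g
  simpa [coeff_apply, inner_conj_symm] using this

/-- By Parseval, moving an operator across the inner product reduces to an identity at each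
frequency. -/
lemma inner_congr_coeff {f g f' g' : L2 ℓ}
    (h : ∀ k, conj (coeff k f) * coeff k g = conj (coeff k f') * coeff k g') :
    inner ℂ f g = inner ℂ f' g' := by
  refine (hasSum_conj_coeff_mul f g).unique ?_
  simp_rw [h]
  exact hasSum_conj_coeff_mul f' g'

lemma coeff_modes (j k : ℤ) : coeff j (modes ℓ k) = if j = k then 1 else 0 :=
  orthonormal_iff_ite.1 (modes ℓ).orthonormal j k

section Multiplier

/-- The Fourier multiplier with the given symbol (and `0` if the symbol exceeds `C`). -/
def multiplier (m : ℤ → ℂ) (C : ℝ) (hm : ∀ k, ‖m k‖ ≤ C) : L2 ℓ →L[ℂ] L2 ℓ :=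
  have hmem : ∀ f : L2 ℓ, Memℓp (fun k => m k * coeff k f) 2 := fun f => by
    rw [memℓp_gen_iff (by norm_num)]
    refine Summable.of_nonneg_of_le (fun k => by positivity) (fun k => ?_)
      ((hasSum_norm_coeff_sq f).summable.mul_left (C ^ 2))
    have : ‖m k‖ ^ 2 ≤ C ^ 2 := by gcongr; exact hm k
    simpa [mul_pow] using mul_le_mul_of_nonneg_right this (sq_nonneg ‖coeff k f‖)
  LinearMap.mkContinuous
    { toFun := fun f => (modes ℓ).repr.symm ⟨fun k => m k * coeff k f, hmem f⟩
      map_add' := fun f g => by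
        rw [← map_add]
        congr 1
        ext k
        exact (congrArg _ (map_add _ _ _)).trans (mul_add _ _ _)
      map_smul' := fun c f => by
        rw [RingHom.id_apply, ← map_smul]
        congr 1
        ext k
        simp [mul_left_comm] } C (fun f => by
    have hC : 0 ≤ C := (norm_nonneg _).trans (hm 0)
    simp only [LinearMap.coe_mk, AddHom.coe_mk, LinearIsometryEquiv.norm_map]
    refine lp.norm_le_of_tsum_le (by norm_num) (by positivity) ?_
    have h := (hasSum_norm_coeff_sq f).mul_left (C ^ 2)
    have h2 : ∀ k, ‖m k * coeff k f‖ ^ 2 ≤ C ^ 2 * ‖coeff k f‖ ^ 2 := fun k => by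
      rw [norm_mul, mul_pow]; gcongr; exact hm k
    have h3 : Summable (fun k => ‖m k * coeff k f‖ ^ 2) :=
      Summable.of_nonneg_of_le (fun k => by positivity) h2 h.summable
    have := (h3.tsum_le_tsum h2 h.summable).trans_eq h.tsum_eq
    simpa [mul_pow] using this)

variable {m : ℤ → ℂ} {C : ℝ} {hm : ∀ k, ‖m k‖ ≤ C}

lemma coeff_multiplier (f : L2 ℓ) (k : ℤ) :
    coeff k (multiplier m C hm f) = m k * coeff k f := by
  simp [multiplier, coeff_eq_repr]

lemma norm_multiplier_le (f : L2 ℓ) : ‖multiplier m C hm f‖ ≤ C * ‖f‖ := by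
  unfold multiplier
  apply (LinearMap.mkContinuous _ _ _).le_of_opNorm_le
  exact LinearMap.mkContinuous_norm_le _ ((norm_nonneg _).trans (hm 0)) _

attribute [irreducible] multiplier

end Multiplier

/-! ### Test functions as elements of `L²` -/

section Dual

variable {φ : ℝ → ℂ}

/-- The function on the circle defined by a periodic function on the line. -/
def circleLift (φ : ℝ → ℂ) (hc : Continuous φ) (hp : Function.Periodic φ ℓ) : C(AddCircle ℓ, ℂ) where
  toFun := hp.lift
  continuous_toFun := continuous_coinduced_dom.mpr hc

/-- The element of `L²` against which the inner product is the pairing with `φ`. -/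
def dual (φ : ℝ → ℂ) (hφ : IsTest ℓ φ) : L2 ℓ :=
  ContinuousMap.toLp 2 volume ℂ (star (circleLift φ hφ.smooth.continuous hφ.periodic))

omit hℓ in
lemma IsTest.deriv (hφ : IsTest ℓ φ) : IsTest ℓ (deriv φ) where
  smooth := by
    have := hφ.smooth
    exact ((contDiff_infty_iff_deriv).1 this).2
  periodic := fun x => by
    have : (fun y => φ (y + ℓ)) = φ := funext hφ.periodic
    rw [← deriv_comp_add_const, this]

lemma pairing_eq_integral (f : AddCircle ℓ → ℂ) (hφ : IsTest ℓ φ) :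
    pairing f φ = ∫ x : AddCircle ℓ, f x * circleLift φ hφ.smooth.continuous hφ.periodic x := by
  have := AddCircle.intervalIntegral_preimage ℓ 0
    (fun x => f x * circleLift φ hφ.smooth.continuous hφ.periodic x)
  rw [zero_add] at this
  rw [← this]
  rfl

/-- The inner product is conjugate-linear on the left, so the conjugate in `dual` restores the
bilinear pairing. Distributional identities thus become statements about continuous functionals on
`L²`. -/
lemma pairing_eq_inner (f : L2 ℓ) (hφ : IsTest ℓ φ) : pairing f φ = inner ℂ (dual φ hφ) f := by
  rw [pairing_eq_integral f hφ, L2.inner_def]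
  refine integral_congr_ae ?_
  filter_upwards [ContinuousMap.coeFn_toLp (p := 2) (𝕜 := ℂ) (volume : Measure (AddCircle ℓ))
    (star (circleLift φ hφ.smooth.continuous hφ.periodic))] with x hx
  simp only [dual, hx]
  simp

/-- The conjugate of the `k`-th mode, as a test function. -/
def modeTest (ℓ : ℝ) (k : ℤ) (x : ℝ) : ℂ :=
  (√ℓ : ℂ)⁻¹ * Complex.exp (-(Complex.I * freq ℓ k) * x)

omit hℓ in
lemma hasDerivAt_modeTest (k : ℤ) (x : ℝ) :
    HasDerivAt (modeTest ℓ k) (-(Complex.I * freq ℓ k) * modeTest ℓ k x) x := by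
  have h1 : HasDerivAt (fun x : ℝ => -(Complex.I * freq ℓ k) * (x : ℂ))
      (-(Complex.I * freq ℓ k)) x := by
    simpa using (Complex.ofRealCLM.hasDerivAt (x := x)).const_mul (-(Complex.I * freq ℓ k))
  have := (h1.cexp).const_mul (√ℓ : ℂ)⁻¹
  exact this.congr_deriv (by simp only [modeTest]; ring)

omit hℓ in
lemma deriv_modeTest (k : ℤ) :
    deriv (modeTest ℓ k) = fun x => -(Complex.I * freq ℓ k) * modeTest ℓ k x :=
  funext fun x => (hasDerivAt_modeTest k x).deriv

omit hℓ in
lemma modeTest_eq (k : ℤ) (x : ℝ) :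
    modeTest ℓ k x = conj ((((√ℓ)⁻¹ : ℂ) • fourier k) (x : AddCircle ℓ)) := by
  rw [ContinuousMap.smul_apply, smul_eq_mul, fourier_coe_apply, map_mul, ← Complex.exp_conj]
  simp only [modeTest, freq, map_inv₀, Complex.conj_ofReal, map_div₀, map_mul, Complex.conj_I,
    map_ofNat, map_intCast]
  congr 2
  push_cast
  ring

omit hℓ in
lemma isTest_modeTest (k : ℤ) : IsTest ℓ (modeTest ℓ k) where
  smooth := by
    unfold modeTest
    have : ContDiff ℝ ∞ (fun x : ℝ => (x : ℂ)) := Complex.ofRealCLM.contDiff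
    fun_prop
  periodic := fun x => by
    rw [modeTest_eq, modeTest_eq, AddCircle.coe_add_period]

lemma dual_modeTest (k : ℤ) : dual (modeTest ℓ k) (isTest_modeTest k) = modes ℓ k := by
  rw [modes_apply, dual]
  congr 1
  ext x
  induction x using QuotientAddGroup.induction_on with
  | H x =>
    have : circleLift (ℓ := ℓ) (modeTest ℓ k) (isTest_modeTest k).smooth.continuous
      (isTest_modeTest k).periodic (x : AddCircle ℓ) = modeTest ℓ k x := rfl
    rw [ContinuousMap.star_apply, this, modeTest_eq]
    simp

lemma pairing_modeTest (f : L2 ℓ) (k : ℤ) : pairing f (modeTest ℓ k) = coeff k f := by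
  rw [pairing_eq_inner f (isTest_modeTest k), dual_modeTest, coeff_apply]

omit hℓ in
lemma pairing_const_mul (f : AddCircle ℓ → ℂ) (c : ℂ) (φ : ℝ → ℂ) :
    pairing f (fun x => c * φ x) = c * pairing f φ := by
  unfold pairing
  rw [← intervalIntegral.integral_const_mul]
  congr 1
  ext x
  ring

omit hℓ in
/-- Integration by parts for periodic functions. -/
lemma integral_deriv_mul_eq {f g f' g' : ℝ → ℂ} (hf : ∀ x, HasDerivAt f (f' x) x)
    (hg : ∀ x, HasDerivAt g (g' x) x) (hf' : Continuous f') (hg' : Continuous g')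
    (hfp : Function.Periodic f ℓ) (hgp : Function.Periodic g ℓ) :
    ∫ x in (0 : ℝ)..ℓ, f' x * g x = -∫ x in (0 : ℝ)..ℓ, f x * g' x := by
  have := intervalIntegral.integral_mul_deriv_eq_deriv_mul (a := 0) (b := ℓ) (fun x _ => hf x)
    (fun x _ => hg x) (hf'.intervalIntegrable _ _) (hg'.intervalIntegrable _ _)
  have h1 : f ℓ = f 0 := by simpa using hfp 0
  have h2 : g ℓ = g 0 := by simpa using hgp 0
  rw [this, h1, h2]
  ring

lemma coeff_dual_deriv (hφ : IsTest ℓ φ) (k : ℤ) :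
    coeff k (dual (deriv φ) hφ.deriv) = Complex.I * freq ℓ k * coeff k (dual φ hφ) := by
  have key : ∀ (ψ : ℝ → ℂ) (hψ : IsTest ℓ ψ), coeff k (dual ψ hψ) =
      conj (∫ x in (0 : ℝ)..ℓ, ψ x * conj (modeTest ℓ k x)) := by
    intro ψ hψ
    rw [coeff_apply, ← inner_conj_symm, ← pairing_eq_inner, modes_apply, pairing_congr
      (ContinuousMap.coeFn_toLp (p := 2) (𝕜 := ℂ) (volume : Measure (AddCircle ℓ)) _)]
    unfold pairing
    congr 2
    ext x
    rw [modeTest_eq]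
    simp [mul_comm]
  rw [key, key]
  have hm : ∀ x, HasDerivAt (fun x => conj (modeTest ℓ k x))
      (Complex.I * freq ℓ k * conj (modeTest ℓ k x)) x := fun x => by
    simpa using (hasDerivAt_modeTest (ℓ := ℓ) k x).star
  have hc : Continuous (modeTest ℓ k) := (isTest_modeTest k).smooth.continuous
  rw [integral_deriv_mul_eq (ℓ := ℓ) (fun x => (hφ.smooth.differentiable (by simp) x).hasDerivAt) hm
    hφ.continuous_deriv (by fun_prop) hφ.periodic
    (fun x => by rw [(isTest_modeTest (ℓ := ℓ) k).periodic x])]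
  have : ∀ x, φ x * (Complex.I * freq ℓ k * conj (modeTest ℓ k x)) =
     (Complex.I * freq ℓ k) * (φ x * conj (modeTest ℓ k x)) := fun x => by ring
  simp_rw [this]
  rw [intervalIntegral.integral_const_mul]
  simp

end Dual

end Fourier

/-! ### The space `H¹`: Fourier description, sup-norm embedding, and the force term -/

section Sobolev

open ComplexConjugate Filter Topology

variable {ℓ : ℝ} [hℓ : Fact (0 < ℓ)]

/-- Testing against the modes gives the coefficients; conversely, Parseval recovers every test
function from them. -/
lemma hasWeakDeriv_iff_coeff {f g : L2 ℓ} :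
    HasWeakDeriv f g ↔ ∀ k, coeff k g = Complex.I * freq ℓ k * coeff k f := by
  refine ⟨fun h k => ?_, fun h φ hφ => ?_⟩
  · rw [← pairing_modeTest, h _ (isTest_modeTest k), deriv_modeTest, pairing_const_mul,
      pairing_modeTest]
    ring
  · rw [pairing_eq_inner g hφ, pairing_eq_inner f hφ.deriv, ← inner_neg_right]
    refine inner_congr_coeff fun k => ?_
    rw [h, coeff_dual_deriv hφ, map_neg]
    simp only [map_mul, Complex.conj_I, Complex.conj_ofReal]
    ring

/-- The inclusion of `H¹` in `L²`, as a continuous linear map. -/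
def H1.fstL : H1 ℓ →L[ℂ] L2 ℓ := (WithLp.fstL 2 ℂ (L2 ℓ) (L2 ℓ)).comp (H1 ℓ).subtypeL

/-- The weak derivative, as a continuous linear map from `H¹` to `L²`. -/
def H1.derivL : H1 ℓ →L[ℂ] L2 ℓ := (WithLp.sndL 2 ℂ (L2 ℓ) (L2 ℓ)).comp (H1 ℓ).subtypeL

lemma H1.toL2_eq (p : H1 ℓ) : H1.toL2 p = H1.fstL p := rfl

lemma H1.coeff_derivL (p : H1 ℓ) (k : ℤ) :
    coeff k (H1.derivL p) = Complex.I * freq ℓ k * coeff k (H1.fstL p) :=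
  hasWeakDeriv_iff_coeff.1 p.2 k

lemma H1.ext_coeff {p q : H1 ℓ} (h : ∀ k, coeff k (H1.fstL p) = coeff k (H1.fstL q)) : p = q := by
  have h1 : H1.fstL p = H1.fstL q := SchrodingerEuler.ext_coeff h
  have h2 : H1.derivL p = H1.derivL q := SchrodingerEuler.ext_coeff fun k => by
    rw [H1.coeff_derivL, H1.coeff_derivL, h]
  apply Subtype.ext
  apply (WithLp.ofLp_injective 2)
  exact Prod.ext h1 h2

lemma H1.norm_derivL_le (p : H1 ℓ) : ‖H1.derivL p‖ ≤ ‖p‖ :=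
  WithLp.norm_snd_le _ p.1

instance : CompleteSpace (H1 ℓ) := by
  have : IsClosed ((H1 ℓ : Submodule ℂ (WithLp 2 (L2 ℓ × L2 ℓ))) : Set (WithLp 2 (L2 ℓ × L2 ℓ))) := by
    -- One closed linear condition per frequency, so the subspace is closed.
    have : ((H1 ℓ : Submodule ℂ (WithLp 2 (L2 ℓ × L2 ℓ))) : Set (WithLp 2 (L2 ℓ × L2 ℓ))) =
        ⋂ k, {p | coeff k (WithLp.sndL 2 ℂ (L2 ℓ) (L2 ℓ) p) =
          Complex.I * freq ℓ k * coeff k (WithLp.fstL 2 ℂ (L2 ℓ) (L2 ℓ) p)} := by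
      ext p
      rw [mem_iInter]
      exact hasWeakDeriv_iff_coeff
    rw [this]
    exact isClosed_iInter fun k => isClosed_eq (by fun_prop) (by fun_prop)
  exact this.completeSpace_coe

omit hℓ in
lemma freq_zero : freq ℓ 0 = 0 := by simp [freq]

lemma freq_ne_zero {k : ℤ} (hk : k ≠ 0) : freq ℓ k ≠ 0 := by
  have : ℓ ≠ 0 := hℓ.out.ne'
  have : (k : ℝ) ≠ 0 := by exact_mod_cast hk
  unfold freq
  positivity

lemma norm_inv_freq_le (k : ℤ) : ‖(((freq ℓ k)⁻¹ : ℝ) : ℂ)‖ ≤ ℓ / (2 * π) := by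
  have h0 := hℓ.out
  rcases eq_or_ne k 0 with rfl | hk
  · rw [freq_zero, inv_zero, Complex.ofReal_zero, norm_zero]
    positivity
  · have : (1 : ℝ) ≤ |(k : ℝ)| := by exact_mod_cast Int.one_le_abs hk
    rw [Complex.norm_real, norm_inv, freq, norm_div, norm_mul, inv_div,
      Real.norm_of_nonneg h0.le, Real.norm_of_nonneg two_pi_pos.le]
    refine div_le_div_of_nonneg_left h0.le two_pi_pos ?_
    exact le_mul_of_one_le_right two_pi_pos.le this

/-- This is the symbol of `∂ₓD⁻¹`. Its boundedness is what lets `D⁻¹` gain a full derivative; at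
frequency `0` the convention `0⁻¹ = 0` makes it vanish. -/
lemma norm_I_mul_freq_mul_inv_le (k : ℤ) :
    ‖Complex.I * freq ℓ k * (((freq ℓ k)⁻¹ : ℝ) : ℂ)‖ ≤ 1 := by
  rcases eq_or_ne k 0 with rfl | hk
  · simp [freq_zero]
  · have : (freq ℓ k : ℂ) ≠ 0 := by exact_mod_cast freq_ne_zero hk
    simp [this]

/-- The Fourier multiplier of symbol `1 / ξ` (`0` at frequency `0`), from `L²` to `H¹`. -/
def antideriv : L2 ℓ →L[ℂ] H1 ℓ :=
  (((WithLp.prodContinuousLinearEquiv 2 ℂ (L2 ℓ) (L2 ℓ)).symm : _ →L[ℂ] _).comp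
    ((multiplier _ _ (norm_inv_freq_le (ℓ := ℓ))).prod (multiplier _ _ (norm_I_mul_freq_mul_inv_le (ℓ := ℓ))))).codRestrict
      (H1 ℓ) (fun f => hasWeakDeriv_iff_coeff.2 fun k => by
        have h1 := coeff_multiplier (hm := (norm_I_mul_freq_mul_inv_le (ℓ := ℓ))) f k
        have h2 := coeff_multiplier (hm := (norm_inv_freq_le (ℓ := ℓ))) f k
        refine Eq.trans h1 (Eq.trans ?_ (congrArg _ h2.symm))
        ring)

lemma coeff_antideriv (f : L2 ℓ) (k : ℤ) :
    coeff k (H1.fstL (antideriv f)) = (((freq ℓ k)⁻¹ : ℝ) : ℂ) * coeff k f :=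
  coeff_multiplier (hm := (norm_inv_freq_le (ℓ := ℓ))) f k

/-- Write `|c| = |ξc| · |ξ|⁻¹` and bound the product by the sum of the two squares, both of which
are summable. -/
lemma H1.summable_norm_coeff (p : H1 ℓ) : Summable fun k => ‖coeff k (H1.fstL p)‖ := by
  have h1 : Summable (fun k : ℤ => ‖coeff k (H1.derivL p)‖ ^ 2 +
      (ℓ / (2 * π)) ^ 2 * (1 / (k : ℝ) ^ 2)) :=
    (hasSum_norm_coeff_sq _).summable.add
      ((Real.summable_one_div_int_pow.2 (by norm_num)).mul_left _)
  refine h1.of_norm_bounded_eventually ?_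
  filter_upwards [Filter.eventually_cofinite_ne 0] with k hk
  have hf := freq_ne_zero (ℓ := ℓ) hk
  have h2 : ‖coeff k (H1.derivL p)‖ = |freq ℓ k| * ‖coeff k (H1.fstL p)‖ := by
    rw [H1.coeff_derivL, norm_mul, norm_mul, Complex.norm_I, one_mul, Complex.norm_real,
      Real.norm_eq_abs]
  have h3 : (ℓ / (2 * π)) ^ 2 * (1 / (k : ℝ) ^ 2) = (|freq ℓ k|⁻¹) ^ 2 := by
    rw [← abs_inv, sq_abs, freq]
    have := hℓ.out.ne'
    field_simp
  rw [h3, norm_norm, h2]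
  have h4 : 0 < |freq ℓ k| := abs_pos.2 hf
  have h5 : ‖coeff k (H1.fstL p)‖ = (|freq ℓ k| * ‖coeff k (H1.fstL p)‖) * |freq ℓ k|⁻¹ := by
    field_simp
  nlinarith [sq_nonneg (|freq ℓ k| * ‖coeff k (H1.fstL p)‖ - |freq ℓ k|⁻¹),
    sq_nonneg (|freq ℓ k| * ‖coeff k (H1.fstL p)‖), sq_nonneg (|freq ℓ k|⁻¹)]

/-- The `k`-th mode, as a continuous function. -/
def modeC (ℓ : ℝ) (k : ℤ) : C(AddCircle ℓ, ℂ) := ((√ℓ)⁻¹ : ℂ) • fourier k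

lemma toLp_modeC (k : ℤ) :
    ContinuousMap.toLp (E := ℂ) 2 (volume : Measure (AddCircle ℓ)) ℂ (modeC ℓ k) = modes ℓ k :=
  (modes_apply k).symm

lemma H1.summable_series (p : H1 ℓ) : Summable fun k => coeff k (H1.fstL p) • modeC ℓ k := by
  refine Summable.of_norm ?_
  refine ((H1.summable_norm_coeff p).mul_right (√ℓ)⁻¹).congr fun k => ?_
  rw [norm_smul, modeC, norm_smul, fourier_norm, mul_one, norm_inv, Complex.norm_real,
    Real.norm_of_nonneg (Real.sqrt_nonneg _)]

/-- The continuous representative, as a linear map. -/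
def H1.toContLinear : H1 ℓ →ₗ[ℂ] C(AddCircle ℓ, ℂ) where
  toFun p := ∑' k, coeff k (H1.fstL p) • modeC ℓ k
  map_add' p q := by
    simp only [map_add, add_smul]
    exact (H1.summable_series p).tsum_add (H1.summable_series q)
  map_smul' c p := by
    simp only [map_smul, smul_eq_mul, mul_smul, RingHom.id_apply]
    exact (H1.summable_series p).tsum_const_smul c

lemma H1.toLp_toContLinear (p : H1 ℓ) :
    ContinuousMap.toLp 2 (volume : Measure (AddCircle ℓ)) ℂ (H1.toContLinear p) = H1.fstL p := by
  have h1 := (H1.summable_series p).hasSum.mapL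
    (ContinuousMap.toLp (E := ℂ) 2 (volume : Measure (AddCircle ℓ)) ℂ)
  simp only [map_smul, toLp_modeC] at h1
  have h2 := (modes ℓ).hasSum_repr (H1.fstL p)
  simp only [← coeff_eq_repr] at h2
  exact h1.unique h2

/-- Closed graph theorem: followed by the injective map into `L²`, the embedding becomes the
continuous inclusion of `H¹` in `L²`. -/
lemma H1.continuous_toContLinear : Continuous (H1.toContLinear (ℓ := ℓ)) := by
  refine LinearMap.continuous_of_seq_closed_graph _ fun u x y hu hTu => ?_
  apply ContinuousMap.toLp_injective (p := 2) (𝕜 := ℂ) (volume : Measure (AddCircle ℓ))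
  rw [H1.toLp_toContLinear]
  have h1 := ((ContinuousMap.toLp (E := ℂ) 2 (volume : Measure (AddCircle ℓ)) ℂ).continuous.tendsto
    y).comp hTu
  have h2 := ((H1.fstL (ℓ := ℓ)).continuous.tendsto x).comp hu
  refine tendsto_nhds_unique h1 (h2.congr fun n => ?_)
  exact (H1.toLp_toContLinear (u n)).symm

/-- The embedding of `H¹` in the continuous functions. -/
def H1.toCont : H1 ℓ →L[ℂ] C(AddCircle ℓ, ℂ) := ⟨H1.toContLinear, H1.continuous_toContLinear⟩

lemma H1.toLp_toCont (p : H1 ℓ) :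
    ContinuousMap.toLp 2 (volume : Measure (AddCircle ℓ)) ℂ (H1.toCont p) = H1.fstL p :=
  H1.toLp_toContLinear p

lemma H1.coeFn_toCont (p : H1 ℓ) : H1.fstL p =ᵐ[volume] H1.toCont p := by
  rw [← H1.toLp_toCont]
  exact ContinuousMap.coeFn_toLp (p := 2) (𝕜 := ℂ) _ _

/-- Multiplication of a square integrable function by a continuous one. -/
def mulL : C(AddCircle ℓ, ℂ) →L[ℂ] L2 ℓ →L[ℂ] L2 ℓ :=
  ((ContinuousLinearMap.mul ℂ ℂ).holderL volume ⊤ 2 2).comp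
    (ContinuousMap.toLp (E := ℂ) ⊤ (volume : Measure (AddCircle ℓ)) ℂ)

lemma coeFn_mulL (h : C(AddCircle ℓ, ℂ)) (f : L2 ℓ) :
    mulL h f =ᵐ[volume] fun x => h x * f x := by
  have h1 := ContinuousLinearMap.coeFn_holder (r := 2) (ContinuousLinearMap.mul ℂ ℂ)
    (ContinuousMap.toLp (E := ℂ) ⊤ (volume : Measure (AddCircle ℓ)) ℂ h) f
  filter_upwards [h1, ContinuousMap.coeFn_toLp (p := ⊤) (𝕜 := ℂ) (volume : Measure (AddCircle ℓ)) h]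
    with x hx hy
  rw [hy] at hx
  exact hx

lemma norm_mulL_le (h : C(AddCircle ℓ, ℂ)) (f : L2 ℓ) :
    ‖mulL h f‖ ≤ ‖mulL (ℓ := ℓ)‖ * ‖h‖ * ‖f‖ := ContinuousLinearMap.le_opNorm₂ _ _ _

/-- The force `-∂ₓ (p₀(u)) = (1 - 3u²) ∂ₓu`. -/
def force (p : H1 ℓ) : L2 ℓ :=
  H1.derivL p - (3 : ℂ) • mulL (H1.toCont p * H1.toCont p) (H1.derivL p)

lemma continuous_force : Continuous (force (ℓ := ℓ)) := by
  unfold force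
  fun_prop

lemma exists_lipschitzOnWith_force (R : ℝ) :
    ∃ K, LipschitzOnWith K (force (ℓ := ℓ)) (Metric.closedBall 0 R) := by
  set m := ‖mulL (ℓ := ℓ)‖
  set e := ‖H1.toCont (ℓ := ℓ)‖
  refine ⟨Real.toNNReal (1 + 9 * m * e ^ 2 * R ^ 2), LipschitzOnWith.of_dist_le_mul
    fun u hu v hv => ?_⟩
  rw [mem_closedBall_zero_iff] at hu hv
  have hR : 0 ≤ R := (norm_nonneg u).trans hu
  have hm : 0 ≤ m := norm_nonneg (mulL (ℓ := ℓ))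
  have he : 0 ≤ e := norm_nonneg (H1.toCont (ℓ := ℓ))
  rw [Real.coe_toNNReal _ (by positivity), dist_eq_norm, dist_eq_norm]
  have hE : ∀ w : H1 ℓ, ‖H1.toCont w‖ ≤ e * ‖w‖ := fun w => ContinuousLinearMap.le_opNorm _ _
  -- The splitting `u²u' - v²v' = u²(u - v)' + (u - v)(u + v)v'`.
  have key : force u - force v = H1.derivL (u - v)
      - (3 : ℂ) • (mulL (H1.toCont u * H1.toCont u) (H1.derivL (u - v))
        + mulL (H1.toCont (u - v) * H1.toCont (u + v)) (H1.derivL v)) := by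
    have h1 : H1.toCont (u - v) * H1.toCont (u + v) =
        H1.toCont u * H1.toCont u - H1.toCont v * H1.toCont v := by
      rw [map_sub, map_add]; ring
    rw [h1]
    simp only [force, map_sub, smul_sub, smul_add, sub_apply]
    abel
  have h1 : ‖mulL (H1.toCont u * H1.toCont u) (H1.derivL (u - v))‖ ≤
      m * ((e * R) * (e * R)) * ‖u - v‖ := by
    refine (norm_mulL_le _ _).trans ?_
    gcongr
    · refine (norm_mul_le _ _).trans ?_
      gcongr <;> exact (hE u).trans (by gcongr)
    · exact H1.norm_derivL_le _
  have h2 : ‖mulL (H1.toCont (u - v) * H1.toCont (u + v)) (H1.derivL v)‖ ≤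
      m * ((e * ‖u - v‖) * (e * (R + R))) * R := by
    refine (norm_mulL_le _ _).trans ?_
    gcongr
    · refine (norm_mul_le _ _).trans ?_
      gcongr
      · exact hE _
      · exact (hE _).trans (by gcongr; exact (norm_add_le _ _).trans (by gcongr))
    · exact (H1.norm_derivL_le _).trans hv
  rw [key]
  calc _ ≤ ‖H1.derivL (u - v)‖ + ‖(3 : ℂ) • (mulL (H1.toCont u * H1.toCont u) (H1.derivL (u - v))
        + mulL (H1.toCont (u - v) * H1.toCont (u + v)) (H1.derivL v))‖ := norm_sub_le _ _
    _ ≤ ‖u - v‖ + 3 * (m * ((e * R) * (e * R)) * ‖u - v‖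
        + m * ((e * ‖u - v‖) * (e * (R + R))) * R) := by
      rw [norm_smul]
      gcongr
      · exact H1.norm_derivL_le _
      · simp
      · exact (norm_add_le _ _).trans (add_le_add h1 h2)
    _ = _ := by ring

end Sobolev

/-! ### The chain rule `∂ₓ(u³) = 3u²∂ₓu` in `H¹`, by density -/

section ProductRule

open ComplexConjugate Filter Topology

variable {ℓ : ℝ} [hℓ : Fact (0 < ℓ)]

/-- The `k`-th mode, as an element of `H¹`. -/
def H1.mode (ℓ : ℝ) [Fact (0 < ℓ)] (k : ℤ) : H1 ℓ :=
  ⟨WithLp.toLp 2 (modes ℓ k, (Complex.I * freq ℓ k) • modes ℓ k), hasWeakDeriv_iff_coeff.2 fun j => by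
    change coeff j ((Complex.I * freq ℓ k) • modes ℓ k) = Complex.I * freq ℓ j * coeff j (modes ℓ k)
    rw [map_smul, smul_eq_mul, coeff_modes]
    split_ifs with h
    · rw [h]
    · simp⟩

lemma H1.fstL_mode (k : ℤ) : H1.fstL (H1.mode ℓ k) = modes ℓ k := rfl

lemma H1.derivL_mode (k : ℤ) : H1.derivL (H1.mode ℓ k) = (Complex.I * freq ℓ k) • modes ℓ k := rfl

lemma H1.isInducing_prod : Topology.IsInducing (H1.fstL.prod (H1.derivL (ℓ := ℓ))) :=
  (WithLp.prodContinuousLinearEquiv 2 ℂ (L2 ℓ) (L2 ℓ)).toHomeomorph.isInducing.comp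
    Topology.IsInducing.subtypeVal

/-- The `H¹` topology is that of joint `L²` convergence of the function and its derivative, and both
Fourier series converge. Trigonometric polynomials are therefore dense in `H¹`. -/
lemma H1.hasSum_mode (p : H1 ℓ) : HasSum (fun k => coeff k (H1.fstL p) • H1.mode ℓ k) p := by
  rw [← H1.isInducing_prod.hasSum_iff]
  have h1 := (modes ℓ).hasSum_repr (H1.fstL p)
  have h2 := (modes ℓ).hasSum_repr (H1.derivL p)
  simp only [← coeff_eq_repr, H1.coeff_derivL] at h1 h2
  convert h1.prodMk h2 using 1
  ext1 k
  rw [Function.comp_apply, map_smul, ContinuousLinearMap.prod_apply, H1.fstL_mode, H1.derivL_mode,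
    Prod.smul_mk, smul_smul, mul_comm (coeff k _)]
  rfl

/-- Elements of `H¹` that are continuously differentiable in the classical sense. -/
def H1.IsC1 (p : H1 ℓ) : Prop :=
  ∃ h : C(AddCircle ℓ, ℂ), H1.derivL p = ContinuousMap.toLp 2 volume ℂ h ∧
    ∀ x : ℝ, HasDerivAt (fun y : ℝ => H1.toCont p (y : AddCircle ℓ)) (h (x : AddCircle ℓ)) x

lemma H1.IsC1.add {p q : H1 ℓ} (hp : H1.IsC1 p) (hq : H1.IsC1 q) : H1.IsC1 (p + q) := by
  obtain ⟨h, h1, h2⟩ := hp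
  obtain ⟨k, h3, h4⟩ := hq
  refine ⟨h + k, by rw [map_add, map_add, h1, h3], fun x => ?_⟩
  rw [map_add]
  exact (h2 x).add (h4 x)

lemma H1.IsC1.smul {p : H1 ℓ} (hp : H1.IsC1 p) (c : ℂ) : H1.IsC1 (c • p) := by
  obtain ⟨h, h1, h2⟩ := hp
  refine ⟨c • h, by rw [map_smul, map_smul, h1], fun x => ?_⟩
  rw [map_smul]
  exact (h2 x).const_smul c

lemma H1.isC1_zero : H1.IsC1 (0 : H1 ℓ) :=
  ⟨0, by rw [map_zero, map_zero], fun x => by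
    rw [map_zero]
    exact hasDerivAt_const x (0 : ℂ)⟩

lemma H1.toCont_mode (k : ℤ) : H1.toCont (H1.mode ℓ k) = modeC ℓ k := by
  apply ContinuousMap.toLp_injective (p := 2) (𝕜 := ℂ) (volume : Measure (AddCircle ℓ))
  rw [H1.toLp_toCont, toLp_modeC, H1.fstL_mode]

lemma H1.isC1_mode (k : ℤ) : H1.IsC1 (H1.mode ℓ k) := by
  refine ⟨(Complex.I * freq ℓ k) • modeC ℓ k, ?_, fun x => ?_⟩
  · rw [map_smul, toLp_modeC, H1.derivL_mode]
  · rw [H1.toCont_mode]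
    have h := (hasDerivAt_fourier ℓ k x).const_mul ((√ℓ)⁻¹ : ℂ)
    refine h.congr_deriv ?_
    simp only [modeC, ContinuousMap.smul_apply, smul_eq_mul, freq]
    push_cast
    ring

lemma H1.isC1_sum (s : Finset ℤ) (c : ℤ → ℂ) : H1.IsC1 (∑ k ∈ s, c k • H1.mode ℓ k) := by
  classical
  induction s using Finset.induction_on with
  | empty => simpa using H1.isC1_zero
  | insert a s ha ih =>
    rw [Finset.sum_insert ha]
    exact ((H1.isC1_mode a).smul _).add ih

variable {φ : ℝ → ℂ}

lemma pairing_continuousMap (f : C(AddCircle ℓ, ℂ)) (φ : ℝ → ℂ) :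
    pairing (ContinuousMap.toLp 2 (volume : Measure (AddCircle ℓ)) ℂ f : L2 ℓ) φ = pairing f φ :=
  pairing_congr (ContinuousMap.coeFn_toLp (p := 2) (𝕜 := ℂ) _ f) φ

lemma H1.IsC1.pairing_cube {p : H1 ℓ} (hp : H1.IsC1 p) (hφ : IsTest ℓ φ) :
    pairing ((3 : ℂ) • mulL (H1.toCont p * H1.toCont p) (H1.derivL p) : L2 ℓ) φ =
      -pairing (H1.toCont p * H1.toCont p * H1.toCont p) (deriv φ) := by
  obtain ⟨h, h1, h2⟩ := hp
  have h3 : ((3 : ℂ) • mulL (H1.toCont p * H1.toCont p) (H1.derivL p) : L2 ℓ) =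
      ContinuousMap.toLp 2 volume ℂ ((3 : ℂ) • (H1.toCont p * H1.toCont p * h)) := by
    rw [map_smul]
    congr 1
    apply Lp.ext
    rw [h1]
    filter_upwards [coeFn_mulL (H1.toCont p * H1.toCont p) (ContinuousMap.toLp 2 volume ℂ h),
      ContinuousMap.coeFn_toLp (p := 2) (𝕜 := ℂ) (volume : Measure (AddCircle ℓ)) h,
      ContinuousMap.coeFn_toLp (p := 2) (𝕜 := ℂ) (volume : Measure (AddCircle ℓ))
        (H1.toCont p * H1.toCont p * h)] with x hx hy hz
    rw [hx, hy, hz]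
    rfl
  rw [h3, pairing_continuousMap]
  have hq : Continuous (fun x : ℝ => (x : AddCircle ℓ)) := AddCircle.continuous_mk' ℓ
  have h4 : ∀ x : ℝ, HasDerivAt
      (fun y : ℝ => (H1.toCont p * H1.toCont p * H1.toCont p) (y : AddCircle ℓ))
      (((3 : ℂ) • (H1.toCont p * H1.toCont p * h)) (x : AddCircle ℓ)) x := fun x => by
    refine (((h2 x).mul (h2 x)).mul (h2 x)).congr_deriv ?_
    simp only [ContinuousMap.smul_apply, ContinuousMap.mul_apply, smul_eq_mul, Pi.mul_apply]
    ring
  refine integral_deriv_mul_eq (ℓ := ℓ) h4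
    (fun x => (hφ.smooth.differentiable (by simp) x).hasDerivAt) ((ContinuousMap.continuous _).comp hq)
    hφ.continuous_deriv (fun x => ?_) hφ.periodic
  rw [AddCircle.coe_add_period]

/-- Both sides are continuous in the `H¹` norm and agree on trigonometric polynomials, where
classical integration by parts applies. -/
lemma H1.pairing_cube (p : H1 ℓ) (hφ : IsTest ℓ φ) :
    pairing ((3 : ℂ) • mulL (H1.toCont p * H1.toCont p) (H1.derivL p) : L2 ℓ) φ =
      -pairing (H1.toCont p * H1.toCont p * H1.toCont p) (deriv φ) := by
  have hc : IsClosed {p : H1 ℓ |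
      pairing ((3 : ℂ) • mulL (H1.toCont p * H1.toCont p) (H1.derivL p) : L2 ℓ) φ =
      -pairing (H1.toCont p * H1.toCont p * H1.toCont p) (deriv φ)} := by
    simp only [← pairing_continuousMap]
    simp only [pairing_eq_inner _ hφ, pairing_eq_inner _ hφ.deriv]
    exact isClosed_eq (by fun_prop) (by fun_prop)
  exact hc.mem_of_tendsto (H1.hasSum_mode p)
    (Eventually.of_forall fun s => (H1.isC1_sum s _).pairing_cube hφ)

lemma H1.pressure_ae (p : H1 ℓ) : (fun x => pressure (H1.toL2 p x)) =ᵐ[volume]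
    (-H1.toCont p + H1.toCont p * H1.toCont p * H1.toCont p : C(AddCircle ℓ, ℂ)) := by
  filter_upwards [H1.coeFn_toCont p] with x hx
  rw [H1.toL2_eq, hx]
  simp only [pressure, ContinuousMap.add_apply, ContinuousMap.neg_apply, ContinuousMap.mul_apply]
  ring

/-- `force` is `-∂ₓ (p₀(u))` in the sense of distributions. -/
lemma pairing_force (p : H1 ℓ) (hφ : IsTest ℓ φ) :
    pairing (force p) φ = pairing (fun x => pressure (H1.toL2 p x)) (deriv φ) := by
  rw [pairing_congr (H1.pressure_ae p), ← pairing_continuousMap, map_add, map_neg, H1.toLp_toCont]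
  have h1 := H1.pairing_cube p hφ
  have h2 : pairing (H1.derivL p) φ = -pairing (H1.fstL p) (deriv φ) := p.2 φ hφ
  rw [← pairing_continuousMap] at h1
  rw [pairing_eq_inner _ hφ, pairing_eq_inner _ hφ.deriv] at h1 h2 ⊢
  rw [force, inner_sub_right, h1, h2, inner_add_right, inner_neg_right]
  ring

end ProductRule

/-! ### The Schrödinger group and the transformed vector field -/

section Evolution

open ComplexConjugate Filter Topology

/-- A curve in a Banach space whose images under a separating family of functionals are
differentiable, with derivatives given by a continuous curve, is differentiable. -/
lemma hasDerivWithinAt_of_separating {X ι : Type*} [NormedAddCommGroup X] [NormedSpace ℂ X]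
    [CompleteSpace X] {Λ : ι → X →L[ℂ] ℂ} (hΛ : ∀ x, (∀ i, Λ i x = 0) → x = 0) {y z : ℝ → X}
    {τ : ℝ} (hz : ContinuousOn z (Icc 0 τ))
    (hy : ∀ i, ∀ t ∈ Icc 0 τ, HasDerivWithinAt (fun s => Λ i (y s)) (Λ i (z t)) (Icc 0 τ) t) :
    ∀ t ∈ Icc 0 τ, HasDerivWithinAt y (z t) (Icc 0 τ) t := by
  intro t ht
  have hτ : 0 ≤ τ := ht.1.trans ht.2
  -- Extending `z` by constants makes its primitive differentiable on the whole line; `y` is then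
  -- shown to equal this primitive on `[0, τ]`.
  set Z : ℝ → X := IccExtend hτ ((Icc 0 τ).domRestrict z) with hZ
  have hZc : Continuous Z := (continuousOn_iff_continuous_domRestrict.1 hz).Icc_extend'
  have hZe : ∀ s ∈ Icc 0 τ, Z s = z s := fun s hs => IccExtend_of_mem hτ _ hs
  set Y : ℝ → X := fun s => y 0 + ∫ r in (0 : ℝ)..s, Z r with hY
  have hYd : ∀ s, HasDerivAt Y (Z s) s := fun s =>
    (intervalIntegral.integral_hasDerivAt_right (hZc.intervalIntegrable _ _)
      (hZc.stronglyMeasurableAtFilter _ _) hZc.continuousAt).const_add _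
  have key : ∀ s ∈ Icc 0 τ, y s = Y s := by
    intro s hs
    refine sub_eq_zero.1 (hΛ _ fun i => ?_)
    have hd : ∀ r ∈ Icc 0 τ,
        HasDerivWithinAt (fun s => Λ i (y s) - Λ i (Y s)) 0 (Icc 0 τ) r := fun r hr => by
      have h2 := ((Λ i).restrictScalars ℝ).hasFDerivAt.comp_hasDerivAt r (hYd r)
      refine ((hy i r hr).sub h2.hasDerivWithinAt).congr_deriv ?_
      rw [hZe r hr]
      exact sub_self _
    have := constant_of_has_deriv_right_zero (fun r hr => (hd r hr).continuousWithinAt)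
      (fun r hr => (hd r (Ico_subset_Icc_self hr)).mono_of_mem_nhdsWithin
        (Icc_mem_nhdsGE_of_mem hr)) s hs
    rw [map_sub, this]
    simp [hY]
  rw [← hZe t ht]
  exact (hYd t).hasDerivWithinAt.congr key (key t ht)

variable {ℓ : ℝ} [hℓ : Fact (0 < ℓ)]

lemma norm_exp_symbol (β t ξ : ℝ) : ‖Complex.exp (Complex.I * (β * ξ ^ 2) * t)‖ ≤ 1 := by
  have : Complex.I * (β * ξ ^ 2) * t = ((β * ξ ^ 2 * t : ℝ) : ℂ) * Complex.I := by
    push_cast; ring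
  rw [this, Complex.norm_exp_ofReal_mul_I]

/-- The Schrödinger group `exp(-iβt∂ₓ²)`. -/
def schrodinger (β t : ℝ) : L2 ℓ →L[ℂ] L2 ℓ :=
  multiplier _ 1 (fun k => norm_exp_symbol β t (freq ℓ k))

lemma coeff_schrodinger (β t : ℝ) (f : L2 ℓ) (k : ℤ) :
    coeff k (schrodinger β t f) = Complex.exp (Complex.I * (β * freq ℓ k ^ 2) * t) * coeff k f :=
  coeff_multiplier f k

lemma norm_schrodinger_le (β t : ℝ) (f : L2 ℓ) : ‖schrodinger β t f‖ ≤ ‖f‖ := by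
  have := norm_multiplier_le (hm := fun k => norm_exp_symbol β t (freq ℓ k)) f
  rwa [one_mul] at this

lemma schrodinger_zero (β : ℝ) (f : L2 ℓ) : schrodinger β 0 f = f :=
  ext_coeff fun k => by rw [coeff_schrodinger]; simp

lemma schrodinger_neg_self (β t : ℝ) (f : L2 ℓ) : schrodinger β t (schrodinger (-β) t f) = f :=
  ext_coeff fun k => by
    rw [coeff_schrodinger, coeff_schrodinger, ← mul_assoc, ← Complex.exp_add]
    push_cast
    ring_nf
    simp

/-- The symbol is unimodular, so conjugating it amounts to changing the sign of `β`. -/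
lemma inner_schrodinger (β t : ℝ) (f g : L2 ℓ) :
    inner ℂ f (schrodinger β t g) = inner ℂ (schrodinger (-β) t f) g :=
  inner_congr_coeff fun k => by
    rw [coeff_schrodinger, coeff_schrodinger, map_mul, ← Complex.exp_conj]
    have : conj (Complex.I * (((-β : ℝ) : ℂ) * (freq ℓ k : ℂ) ^ 2) * (t : ℂ)) =
        Complex.I * (β * (freq ℓ k : ℂ) ^ 2) * t := by
      simp only [map_mul, Complex.conj_I, Complex.conj_ofReal, map_pow]
      push_cast
      ring
    rw [this]
    ring

/-- By Parseval the squared increment is a series of continuous functions of `t` dominated by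
`4‖coeff k f‖²`. Only strong continuity is claimed. -/
lemma continuous_schrodinger_apply (β : ℝ) (f : L2 ℓ) :
    Continuous fun t => schrodinger β t f := by
  rw [continuous_iff_continuousAt]
  intro t₀
  have h1 : ∀ t, ‖schrodinger β t f - schrodinger β t₀ f‖ ^ 2 =
      ∑' k, ‖(Complex.exp (Complex.I * (β * freq ℓ k ^ 2) * t) -
        Complex.exp (Complex.I * (β * freq ℓ k ^ 2) * t₀)) * coeff k f‖ ^ 2 := fun t => by
    rw [← (hasSum_norm_coeff_sq _).tsum_eq]
    refine tsum_congr fun k => ?_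
    rw [map_sub, coeff_schrodinger, coeff_schrodinger, sub_mul]
  have h2 : Continuous fun t : ℝ =>
      ∑' k, ‖(Complex.exp (Complex.I * (β * freq ℓ k ^ 2) * t) -
        Complex.exp (Complex.I * (β * freq ℓ k ^ 2) * t₀)) * coeff k f‖ ^ 2 := by
    refine continuous_tsum (fun k => by fun_prop)
      ((hasSum_norm_coeff_sq f).summable.mul_left 4) fun k t => ?_
    have h4 : ‖Complex.exp (Complex.I * (β * freq ℓ k ^ 2) * t) -
        Complex.exp (Complex.I * (β * freq ℓ k ^ 2) * t₀)‖ ≤ 2 := by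
      refine (norm_sub_le _ _).trans ?_
      have := norm_exp_symbol β t (freq ℓ k)
      have := norm_exp_symbol β t₀ (freq ℓ k)
      linarith
    rw [norm_pow, norm_norm, norm_mul, mul_pow]
    gcongr
    calc _ ≤ (2 : ℝ) ^ 2 := by gcongr
      _ = 4 := by norm_num
  have h3 : Tendsto (fun t => ‖schrodinger β t f - schrodinger β t₀ f‖ ^ 2) (𝓝 t₀) (𝓝 0) := by
    simp only [h1]
    convert h2.tendsto t₀ using 2
    simp
  rw [ContinuousAt, tendsto_iff_norm_sub_tendsto_zero]
  simpa using h3.sqrt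

lemma continuous_schrodinger (β : ℝ) :
    Continuous fun p : L2 ℓ × ℝ => schrodinger β p.2 p.1 := by
  refine continuous_prod_of_continuous_lipschitzWith _ 1
    (fun f => continuous_schrodinger_apply β f) fun t => ?_
  refine LipschitzWith.of_dist_le_mul fun f g => ?_
  simp only [dist_eq_norm, ← map_sub, NNReal.coe_one, one_mul]
  exact norm_schrodinger_le _ _ _

lemma continuousOn_schrodinger {β : ℝ} {w : ℝ → L2 ℓ} {s : Set ℝ} (hw : ContinuousOn w s) :
    ContinuousOn (fun t => schrodinger β t (w t)) s := by
  have h1 : ContinuousOn (fun t => (w t, t)) s := hw.prodMk continuousOn_id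
  simpa only [Function.comp_def] using (continuous_schrodinger β).comp_continuousOn h1

lemma hasDerivAt_exp_symbol (c : ℂ) (t : ℝ) :
    HasDerivAt (fun s : ℝ => Complex.exp (c * s)) (c * Complex.exp (c * t)) t := by
  have h1 : HasDerivAt (fun x : ℝ => c * (x : ℂ)) c t := by
    simpa using (Complex.ofRealCLM.hasDerivAt (x := t)).const_mul c
  exact h1.cexp.congr_deriv (mul_comm _ _)

/-- The existence of `g` says that `f` lies in the domain of the generator. -/
lemma hasDerivWithinAt_schrodinger {β : ℝ} {f g : L2 ℓ}
    (h : ∀ k, coeff k g = Complex.I * (β * freq ℓ k ^ 2) * coeff k f) {τ t : ℝ}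
    (ht : t ∈ Icc 0 τ) :
    HasDerivWithinAt (fun s => schrodinger β s f) (schrodinger β t g) (Icc 0 τ) t := by
  refine hasDerivWithinAt_of_separating (Λ := coeff)
    (fun x hx => ext_coeff fun k => by rw [hx, map_zero])
    (continuous_schrodinger_apply β g).continuousOn (fun k t _ => ?_) t ht
  simp only [coeff_schrodinger, h]
  refine ((hasDerivAt_exp_symbol (Complex.I * (β * freq ℓ k ^ 2)) t).mul_const
    (coeff k f)).hasDerivWithinAt.congr_deriv ?_
  ring

/-- The curve `w` is only in `L²`, outside the domain of the generator in general, so the group is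
moved onto the smoother `ψ` before differentiating. -/
lemma hasDerivWithinAt_inner_schrodinger {β : ℝ} {ψ ξ : L2 ℓ}
    (h : ∀ k, coeff k ξ = -(Complex.I * (β * freq ℓ k ^ 2)) * coeff k ψ) {τ t : ℝ}
    (ht : t ∈ Icc 0 τ) {w : ℝ → L2 ℓ} {w' : L2 ℓ} (hw : HasDerivWithinAt w w' (Icc 0 τ) t) :
    HasDerivWithinAt (fun s => inner ℂ ψ (schrodinger β s (w s)))
      (inner ℂ ξ (schrodinger β t (w t)) + inner ℂ ψ (schrodinger β t w')) (Icc 0 τ) t := by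
  have h1 : HasDerivWithinAt (fun s => schrodinger (-β) s ψ) (schrodinger (-β) t ξ) (Icc 0 τ) t :=
    hasDerivWithinAt_schrodinger (fun k => by rw [h]; push_cast; ring) ht
  simp only [inner_schrodinger]
  exact (h1.inner ℂ hw).congr_deriv (add_comm _ _)

/-- The first component of the solution, from the variables
`(u₁ + β⁻¹ D⁻¹ u₂, exp(iβt∂ₓ²) u₂)`. -/
def recover (β t : ℝ) (x : H1 ℓ × L2 ℓ) : H1 ℓ :=
  x.1 - (β⁻¹ : ℂ) • antideriv (schrodinger β t x.2)

/-- The vector field of the equation in the variables `(u₁ + β⁻¹ D⁻¹ u₂, exp(iβt∂ₓ²) u₂)`. -/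
def field (β t : ℝ) (x : H1 ℓ × L2 ℓ) : H1 ℓ × L2 ℓ :=
  ((β⁻¹ : ℂ) • antideriv (force (recover β t x)), schrodinger (-β) t (force (recover β t x)))

lemma continuousOn_recover {β : ℝ} {x : ℝ → H1 ℓ × L2 ℓ} {s : Set ℝ} (hx : ContinuousOn x s) :
    ContinuousOn (fun t => recover β t (x t)) s := by
  have := continuousOn_schrodinger (β := β) hx.snd
  have h1 := ((antideriv (ℓ := ℓ)).continuous.const_smul (β⁻¹ : ℂ)).comp_continuousOn this
  exact hx.fst.sub h1

lemma continuousOn_field {β : ℝ} {x : ℝ → H1 ℓ × L2 ℓ} {s : Set ℝ} (hx : ContinuousOn x s) :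
    ContinuousOn (fun t => field β t (x t)) s := by
  have h1 := continuous_force.comp_continuousOn (continuousOn_recover (β := β) hx)
  have h2 := ((antideriv (ℓ := ℓ)).continuous.const_smul (β⁻¹ : ℂ)).comp_continuousOn h1
  exact h2.prodMk (continuousOn_schrodinger h1)

lemma recover_zero (β t : ℝ) : recover β t (0 : H1 ℓ × L2 ℓ) = 0 := by
  simp [recover]

lemma field_zero (β t : ℝ) : field β t (0 : H1 ℓ × L2 ℓ) = 0 := by
  rw [field, recover_zero]
  simp [force]

lemma norm_inv_smul_antideriv_le {β₀ β : ℝ} (h₀ : 0 < β₀) (h : β₀ ≤ β) (f : L2 ℓ) :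
    ‖(β⁻¹ : ℂ) • antideriv f‖ ≤ β₀⁻¹ * ‖antideriv (ℓ := ℓ)‖ * ‖f‖ := by
  rw [norm_smul, norm_inv, Complex.norm_real, Real.norm_of_nonneg (h₀.le.trans h), mul_assoc]
  gcongr
  exact ContinuousLinearMap.le_opNorm _ _

lemma norm_recover_sub_le {β₀ β : ℝ} (h₀ : 0 < β₀) (h : β₀ ≤ β) (t : ℝ) (x y : H1 ℓ × L2 ℓ) :
    ‖recover β t x - recover β t y‖ ≤ (1 + β₀⁻¹ * ‖antideriv (ℓ := ℓ)‖) * ‖x - y‖ := by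
  have : recover β t x - recover β t y =
      (x - y).1 - (β⁻¹ : ℂ) • antideriv (schrodinger β t (x - y).2) := by
    simp only [recover, Prod.fst_sub, Prod.snd_sub, map_sub, smul_sub]
    abel
  rw [this, add_mul, one_mul]
  refine (norm_sub_le _ _).trans (add_le_add (norm_fst_le _) ?_)
  refine (norm_inv_smul_antideriv_le h₀ h _).trans ?_
  gcongr
  exact (norm_schrodinger_le _ _ _).trans (norm_snd_le _)

lemma norm_recover_le {β₀ β : ℝ} (h₀ : 0 < β₀) (h : β₀ ≤ β) (t : ℝ) (x : H1 ℓ × L2 ℓ) :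
    ‖recover β t x‖ ≤ (1 + β₀⁻¹ * ‖antideriv (ℓ := ℓ)‖) * ‖x‖ := by
  simpa [recover_zero] using norm_recover_sub_le h₀ h t x 0

/-- The parameter `β` enters only through `β⁻¹ ≤ β₀⁻¹` and through the group, a contraction for
every `β` and `t`. Hence one constant `K` serves all of them, and the existence time does not shrink
as `β` grows. -/
lemma exists_lipschitzOnWith_field {β₀ : ℝ} (h₀ : 0 < β₀) (R : ℝ) :
    ∃ K, ∀ β, β₀ ≤ β → ∀ t, LipschitzOnWith K (field (ℓ := ℓ) β t) (Metric.closedBall 0 R) := by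
  set c := 1 + β₀⁻¹ * ‖antideriv (ℓ := ℓ)‖ with hc
  have hc1 : 1 ≤ c := by rw [hc]; linarith [show 0 ≤ β₀⁻¹ * ‖antideriv (ℓ := ℓ)‖ by positivity]
  obtain ⟨K, hK⟩ := exists_lipschitzOnWith_force (ℓ := ℓ) (c * R)
  refine ⟨Real.toNNReal (c * (K * c)), fun β hβ t => LipschitzOnWith.of_dist_le_mul
    fun x hx y hy => ?_⟩
  have hmem : ∀ x : H1 ℓ × L2 ℓ, x ∈ Metric.closedBall 0 R →
      recover β t x ∈ Metric.closedBall 0 (c * R) := fun x hx => by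
    rw [mem_closedBall_zero_iff] at hx ⊢
    exact (norm_recover_le h₀ hβ t x).trans (by gcongr)
  have h1 : ‖force (recover β t x) - force (recover β t y)‖ ≤ K * (c * ‖x - y‖) := by
    have := hK.dist_le_mul _ (hmem x hx) _ (hmem y hy)
    rw [dist_eq_norm, dist_eq_norm] at this
    refine this.trans ?_
    gcongr
    exact norm_recover_sub_le h₀ hβ t x y
  have h2 : field β t x - field β t y =
      ((β⁻¹ : ℂ) • antideriv (force (recover β t x) - force (recover β t y)),
        schrodinger (-β) t (force (recover β t x) - force (recover β t y))) := by
    simp only [field, Prod.mk_sub_mk, map_sub, smul_sub]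
  rw [Real.coe_toNNReal _ (by positivity), dist_eq_norm, dist_eq_norm, h2]
  have h3 : c * (K * c) * ‖x - y‖ = c * (K * (c * ‖x - y‖)) := by ring
  rw [h3]
  refine le_trans ?_ (mul_le_mul_of_nonneg_left h1 (by linarith))
  refine norm_prod_le_iff.2 ⟨?_, ?_⟩
  · refine (norm_inv_smul_antideriv_le h₀ hβ _).trans ?_
    gcongr
    rw [hc]; linarith
  · exact (norm_schrodinger_le _ _ _).trans (le_mul_of_one_le_left (norm_nonneg _) hc1)

end Evolution

/-! ### Normal form, uniqueness, and existence uniform in `β` -/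

section WellPosedness

open ComplexConjugate Filter Topology

variable {ℓ : ℝ} [hℓ : Fact (0 < ℓ)]

/-- The change of variables `(u₁, u₂) ↦ (u₁ + β⁻¹ D⁻¹ u₂, exp(iβt∂ₓ²) u₂)`. -/
def normalForm (β t : ℝ) (p : H1 ℓ × L2 ℓ) : H1 ℓ × L2 ℓ :=
  (p.1 + (β⁻¹ : ℂ) • antideriv p.2, schrodinger (-β) t p.2)

lemma recover_normalForm (β t : ℝ) (p : H1 ℓ × L2 ℓ) : recover β t (normalForm β t p) = p.1 := by
  simp only [recover, normalForm, schrodinger_neg_self, add_sub_cancel_right]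

lemma field_normalForm (β t : ℝ) (p : H1 ℓ × L2 ℓ) : field β t (normalForm β t p) =
    ((β⁻¹ : ℂ) • antideriv (force p.1), schrodinger (-β) t (force p.1)) := by
  rw [field, recover_normalForm]

omit hℓ in
lemma deriv_deriv_modeTest (k : ℤ) :
    deriv (deriv (modeTest ℓ k)) = fun x => -(freq ℓ k : ℂ) ^ 2 * modeTest ℓ k x := by
  rw [deriv_modeTest]
  ext x
  rw [((hasDerivAt_modeTest k x).const_mul _).deriv, ← mul_assoc]
  congr 1
  ring_nf
  rw [Complex.I_sq]
  ring

variable {β τ : ℝ} {u : ℝ → H1 ℓ × L2 ℓ}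

lemma IsSolution.coeff_mass (hu : IsSolution β τ u) (k : ℤ) {t : ℝ} (ht : t ∈ Icc 0 τ) :
    HasDerivWithinAt (fun s => coeff k (H1.fstL (u s).1))
      (-(Complex.I * freq ℓ k) * coeff k (u t).2) (Icc 0 τ) t := by
  have := hu.mass _ (isTest_modeTest k) t ht
  simpa only [pairing_modeTest, deriv_modeTest, pairing_const_mul, H1.toL2_eq] using this

lemma IsSolution.coeff_momentum (hu : IsSolution β τ u) (k : ℤ) {t : ℝ} (ht : t ∈ Icc 0 τ) :
    HasDerivWithinAt (fun s => coeff k (u s).2)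
      (coeff k (force (u t).1) + Complex.I * (β * freq ℓ k ^ 2) * coeff k (u t).2)
      (Icc 0 τ) t := by
  have := hu.momentum _ (isTest_modeTest k) t ht
  rw [← pairing_force _ (isTest_modeTest k), deriv_deriv_modeTest] at this
  simp only [pairing_modeTest, pairing_const_mul] at this
  exact this.congr_deriv (by ring)

/-- At each nonzero frequency, `β⁻¹ξ⁻¹` times the dispersive term `iβξ² û₂` cancels `-iξ û₂`; at
frequency `0` both vanish. The result is continuous in time with values in `H¹ × L²`, so the
modewise derivatives assemble into a derivative in norm. -/
lemma IsSolution.hasDerivWithinAt_normalForm (hβ : β ≠ 0) (hu : IsSolution β τ u) {t : ℝ}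
    (ht : t ∈ Icc 0 τ) :
    HasDerivWithinAt (fun s => normalForm β s (u s)) (field β t (normalForm β t (u t)))
      (Icc 0 τ) t := by
  have hβ' : (β : ℂ) ≠ 0 := by exact_mod_cast hβ
  have hF : ContinuousOn (fun s => force (u s).1) (Icc 0 τ) :=
    continuous_force.comp_continuousOn hu.continuousOn.fst
  rw [field_normalForm]
  have h1 := hasDerivWithinAt_of_separating (X := H1 ℓ) (Λ := fun k => (coeff k).comp H1.fstL)
    (fun x hx => H1.ext_coeff fun k => (hx k).trans (by simp))
    (y := fun s => (u s).1 + (β⁻¹ : ℂ) • antideriv (u s).2)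
    (z := fun s => (β⁻¹ : ℂ) • antideriv (force (u s).1))
    (((antideriv (ℓ := ℓ)).continuous.const_smul (β⁻¹ : ℂ)).comp_continuousOn hF)
    (fun k t ht => by
      simp only [ContinuousLinearMap.comp_apply, map_add, map_smul, coeff_antideriv, smul_eq_mul]
      refine ((hu.coeff_mass k ht).add
        (((hu.coeff_momentum k ht).const_mul _).const_mul _)).congr_deriv ?_
      rcases eq_or_ne k 0 with rfl | hk
      · simp [freq_zero]
      · have : (freq ℓ k : ℂ) ≠ 0 := by exact_mod_cast freq_ne_zero hk
        push_cast
        field_simp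
        ring) t ht
  have h2 := hasDerivWithinAt_of_separating (X := L2 ℓ) (Λ := coeff)
    (fun x hx => ext_coeff fun k => by rw [hx, map_zero])
    (y := fun s => schrodinger (-β) s (u s).2)
    (z := fun s => schrodinger (-β) s (force (u s).1)) (continuousOn_schrodinger hF)
    (fun k t ht => by
      simp only [coeff_schrodinger]
      refine ((hasDerivAt_exp_symbol _ t).hasDerivWithinAt.mul
        (hu.coeff_momentum k ht)).congr_deriv ?_
      push_cast
      ring) t ht
  exact h1.prodMk h2

/-- Uniqueness for the Cauchy problem. -/
theorem IsSolution.eqOn (hβ : 0 < β) {v : ℝ → H1 ℓ × L2 ℓ} (hu : IsSolution β τ u)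
    (hv : IsSolution β τ v) (h0 : u 0 = v 0) : EqOn u v (Icc 0 τ) := by
  have hc : ∀ {u : ℝ → H1 ℓ × L2 ℓ}, IsSolution β τ u →
      ContinuousOn (fun s => normalForm β s (u s)) (Icc 0 τ) := fun hu t ht =>
    (hu.hasDerivWithinAt_normalForm hβ.ne' ht).continuousWithinAt
  obtain ⟨R₁, hR₁⟩ := (isCompact_Icc.image_of_continuousOn (hc hu)).isBounded.subset_closedBall 0
  obtain ⟨R₂, hR₂⟩ := (isCompact_Icc.image_of_continuousOn (hc hv)).isBounded.subset_closedBall 0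
  obtain ⟨K, hK⟩ := exists_lipschitzOnWith_field (ℓ := ℓ) hβ (max R₁ R₂)
  have hd : ∀ {u : ℝ → H1 ℓ × L2 ℓ}, IsSolution β τ u → ∀ t ∈ Ico 0 τ,
      HasDerivWithinAt (fun s => normalForm β s (u s)) (field β t (normalForm β t (u t)))
        (Ici t) t := fun hu t ht =>
    (hu.hasDerivWithinAt_normalForm hβ.ne' (Ico_subset_Icc_self ht)).mono_of_mem_nhdsWithin
      (Icc_mem_nhdsGE_of_mem ht)
  have key := ODE_solution_unique_of_mem_Icc_right (v := field β)
    (s := fun _ => Metric.closedBall 0 (max R₁ R₂)) (fun t _ => hK β le_rfl t)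
    (hc hu) (hd hu)
    (fun t ht => Metric.closedBall_subset_closedBall (le_max_left _ _)
      (hR₁ (mem_image_of_mem _ (Ico_subset_Icc_self ht))))
    (hc hv) (hd hv)
    (fun t ht => Metric.closedBall_subset_closedBall (le_max_right _ _)
      (hR₂ (mem_image_of_mem _ (Ico_subset_Icc_self ht))))
    (by simp only [h0])
  intro t ht
  have h1 : normalForm β t (u t) = normalForm β t (v t) := key ht
  refine Prod.ext ?_ ?_
  · rw [← recover_normalForm β t (u t), h1, recover_normalForm]
  · have h2 : schrodinger (-β) t (u t).2 = schrodinger (-β) t (v t).2 := congrArg Prod.snd h1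
    rw [← schrodinger_neg_self β t (u t).2, h2, schrodinger_neg_self]

lemma inner_antideriv (f g : L2 ℓ) :
    inner ℂ f (H1.fstL (antideriv g)) = inner ℂ (H1.fstL (antideriv f)) g :=
  inner_congr_coeff fun k => by
    rw [coeff_antideriv, coeff_antideriv, map_mul, Complex.conj_ofReal]
    ring

/-- The converse of the normal form computation, carried out on the test functions. -/
lemma isSolution_of_hasDerivWithinAt_field (hβ : β ≠ 0) {x : ℝ → H1 ℓ × L2 ℓ}
    (hx : ∀ t ∈ Icc 0 τ, HasDerivWithinAt x (field β t (x t)) (Icc 0 τ) t) :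
    IsSolution β τ (fun t => (recover β t (x t), schrodinger β t (x t).2)) := by
  have hβ' : (β : ℂ) ≠ 0 := by exact_mod_cast hβ
  have hc : ContinuousOn x (Icc 0 τ) := fun t ht => (hx t ht).continuousWithinAt
  have hx2 : ∀ t ∈ Icc 0 τ, HasDerivWithinAt (fun s => (x s).2)
      (schrodinger (-β) t (force (recover β t (x t)))) (Icc 0 τ) t := fun t ht => (hx t ht).snd
  refine ⟨(continuousOn_recover hc).prodMk (continuousOn_schrodinger hc.snd), ?_, ?_⟩
  · intro φ hφ t ht
    have hx1 : HasDerivWithinAt (fun s => H1.fstL (x s).1)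
        (H1.fstL ((β⁻¹ : ℂ) • antideriv (force (recover β t (x t))))) (Icc 0 τ) t :=
      (H1.fstL.restrictScalars ℝ).hasFDerivAt.comp_hasDerivWithinAt t (hx t ht).fst
    have h1 : HasDerivWithinAt (fun s => inner ℂ (dual φ hφ) (H1.fstL (x s).1)) _ (Icc 0 τ) t :=
      (hasDerivWithinAt_const t (Icc 0 τ) (dual φ hφ)).inner ℂ hx1
    -- With `D⁻¹` moved onto the test function, the generator has symbol `-iβξ² · ξ⁻¹ = -iβξ`, which
    -- is `-β∂ₓ`. After the factor `-β⁻¹` this leaves the flux `u₂`, and the two force contributions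
    -- cancel.
    have h2 := hasDerivWithinAt_inner_schrodinger (β := β) (ψ := H1.fstL (antideriv (dual φ hφ)))
      (ξ := (-β : ℂ) • dual (deriv φ) hφ.deriv) (fun k => by
        rw [map_smul, coeff_dual_deriv hφ, coeff_antideriv, smul_eq_mul]
        rcases eq_or_ne k 0 with rfl | hk
        · simp [freq_zero]
        · have : (freq ℓ k : ℂ) ≠ 0 := by exact_mod_cast freq_ne_zero hk
          push_cast
          field_simp) ht (hx2 t ht)
    simp only [pairing_eq_inner _ hφ, pairing_eq_inner _ hφ.deriv, H1.toL2_eq, recover, map_sub,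
      map_smul, inner_sub_right, inner_smul_right, inner_antideriv]
    refine (h1.sub (h2.const_mul (β⁻¹ : ℂ))).congr_deriv ?_
    rw [schrodinger_neg_self, inner_zero_left, map_smul, inner_smul_right, inner_antideriv,
      inner_smul_left]
    simp only [map_neg, Complex.conj_ofReal]
    field_simp
    ring
  · intro φ hφ t ht
    have h2 := hasDerivWithinAt_inner_schrodinger (β := β) (ψ := dual φ hφ)
      (ξ := (Complex.I * β) • dual (deriv (deriv φ)) hφ.deriv.deriv) (fun k => by
        rw [map_smul, coeff_dual_deriv hφ.deriv, coeff_dual_deriv hφ, smul_eq_mul]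
        ring_nf
        rw [Complex.I_pow_three]
        ring) ht (hx2 t ht)
    rw [← pairing_force _ hφ]
    simp only [pairing_eq_inner _ hφ, pairing_eq_inner _ hφ.deriv.deriv]
    refine h2.congr_deriv ?_
    rw [schrodinger_neg_self, inner_smul_left]
    simp only [map_mul, Complex.conj_I, Complex.conj_ofReal]
    ring

/-- A version of the Picard-Lindelöf theorem that keeps track of the ball that contains the
solution. -/
lemma exists_hasDerivWithinAt_mem_closedBall {E : Type*} [NormedAddCommGroup E] [NormedSpace ℝ E]
    [CompleteSpace E] {f : ℝ → E → E} {tmin tmax : ℝ} {t₀ : Icc tmin tmax} {x₀ : E}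
    {a L K : NNReal} (hf : IsPicardLindelof f t₀ x₀ a 0 L K) :
    ∃ α : ℝ → E, α t₀ = x₀ ∧ (∀ t, α t ∈ Metric.closedBall x₀ a) ∧
      ∀ t ∈ Icc tmin tmax, HasDerivWithinAt α (f t (α t)) (Icc tmin tmax) t := by
  have hx : x₀ ∈ Metric.closedBall x₀ ((0 : NNReal) : ℝ) := Metric.mem_closedBall_self le_rfl
  obtain ⟨α, hα⟩ := ODE.FunSpace.exists_isFixedPt_next hf hx
  refine ⟨α.compProj, by rw [ODE.FunSpace.compProj_val, ← hα, ODE.FunSpace.next_apply₀],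
    fun t => α.compProj_mem_closedBall hf.mul_max_le, fun t ht => ?_⟩
  refine (ODE.hasDerivWithinAt_picard_Icc t₀.2 hf.continuousOn_uncurry
    α.continuous_compProj.continuousOn (fun _ _ => α.compProj_mem_closedBall hf.mul_max_le)
    x₀ ht).congr_of_mem (fun t' ht' => ?_) ht
  nth_rw 1 [← hα]
  rw [ODE.FunSpace.compProj_of_mem ht', ODE.FunSpace.next_apply]

/-- Existence for bounded data, on a time interval that does not depend on `β ≥ 1`. -/
theorem exists_isSolution (ℓ : ℝ) [Fact (0 < ℓ)] (ρ : ℝ) :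
    ∃ T : ℝ, 0 < T ∧ ∃ C : ℝ, ∀ β : ℝ, 1 ≤ β → ∀ (a : H1 ℓ) (b : L2 ℓ), ‖a‖ ≤ ρ → ‖b‖ ≤ ρ →
      ∃ u : ℝ → H1 ℓ × L2 ℓ, IsSolution β T u ∧ u 0 = (a, b) ∧
        ∀ t, ‖(u t).1‖ ≤ C ∧ ‖(u t).2‖ ≤ C := by
  set c := 1 + 1⁻¹ * ‖antideriv (ℓ := ℓ)‖ with hc
  have hc1 : 1 ≤ c := by rw [hc]; linarith [show 0 ≤ 1⁻¹ * ‖antideriv (ℓ := ℓ)‖ by positivity]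
  -- Transformed data have norm at most `cρ`, and the Picard iteration runs in a ball of radius `1`
  -- around them.
  set R := |c * ρ| + 1
  have hR : 0 ≤ R := by positivity
  obtain ⟨K, hK⟩ := exists_lipschitzOnWith_field (ℓ := ℓ) one_pos R
  -- The field vanishes at `0` and is `K`-Lipschitz, so its norm is at most `KR` and the curve moves
  -- by at most `1` in this time. The factor `c` in the bound is the cost of recovering `u₁`.
  refine ⟨1 / (K * R + 1), by positivity, c * R, fun β hβ a b ha hb => ?_⟩
  set x₀ : H1 ℓ × L2 ℓ := (a + (β⁻¹ : ℂ) • antideriv b, b)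
  have hx₀ : ‖x₀‖ ≤ |c * ρ| := by
    refine le_trans ?_ (le_abs_self _)
    have hρ : 0 ≤ ρ := (norm_nonneg _).trans ha
    refine norm_prod_le_iff.2 ⟨?_, hb.trans (le_mul_of_one_le_left hρ hc1)⟩
    calc ‖a + (β⁻¹ : ℂ) • antideriv b‖ ≤ ‖a‖ + 1⁻¹ * ‖antideriv (ℓ := ℓ)‖ * ‖b‖ :=
          (norm_add_le _ _).trans (by gcongr; exact norm_inv_smul_antideriv_le one_pos hβ b)
      _ ≤ ρ + 1⁻¹ * ‖antideriv (ℓ := ℓ)‖ * ρ := by gcongr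
      _ = c * ρ := by rw [hc]; ring
  have hsub : Metric.closedBall x₀ ((1 : NNReal) : ℝ) ⊆ Metric.closedBall 0 R := by
    refine Metric.closedBall_subset_closedBall' ?_
    rw [dist_zero_right, NNReal.coe_one]
    linarith
  have hT : (0 : ℝ) ≤ 1 / (K * R + 1) := by positivity
  have hPL : IsPicardLindelof (field β) (tmin := 0) (tmax := 1 / (K * R + 1))
      ⟨0, left_mem_Icc.2 hT⟩ x₀ 1 0 (K * R.toNNReal) K := by
    refine ⟨fun t _ => (hK β hβ t).mono hsub, fun x _ => continuousOn_field continuousOn_const,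
      fun t _ x hx => ?_, ?_⟩
    · have h1 := (hK β hβ t).dist_le_mul _ (hsub hx) 0 (Metric.mem_closedBall_self hR)
      rw [field_zero, dist_zero_right, dist_zero_right] at h1
      refine h1.trans ?_
      rw [NNReal.coe_mul, Real.coe_toNNReal _ hR]
      gcongr
      exact mem_closedBall_zero_iff.1 (hsub hx)
    · have h1 : (K : ℝ) * R * (1 / (K * R + 1)) ≤ 1 := by
        rw [mul_one_div]
        exact div_le_one_of_le₀ (by linarith) (by positivity)
      rw [NNReal.coe_mul, Real.coe_toNNReal _ hR, sub_zero, sub_self, max_eq_left hT]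
      simpa using h1
  obtain ⟨x, hx0, hxm, hxd⟩ := exists_hasDerivWithinAt_mem_closedBall hPL
  have hx0' : x 0 = x₀ := hx0
  refine ⟨_, isSolution_of_hasDerivWithinAt_field (by positivity) hxd, ?_, fun t => ?_⟩
  · simp only [hx0', recover, schrodinger_zero, x₀, add_sub_cancel_right]
  · have h1 : ‖x t‖ ≤ R := mem_closedBall_zero_iff.1 (hsub (hxm t))
    have h2 : c * ‖x t‖ ≤ c * R := by gcongr
    exact ⟨(norm_recover_le one_pos hβ t (x t)).trans h2,
      (norm_schrodinger_le _ _ _).trans ((norm_snd_le _).trans (h1.trans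
        (le_mul_of_one_le_left hR hc1)))⟩

end WellPosedness

/-! ### Pullback along the covering `x ↦ x / s` -/

section Pullback

open ComplexConjugate Filter Topology

variable {ℓ L : ℝ} {s : ℝ} {n : ℕ}

/-- The covering `ℝ/ℓℤ → ℝ/Lℤ`, `x ↦ x / s`, for `ℓ` an integer multiple of `L s`. -/
def cover (hs : 0 < s) (h : ℓ = n * (L * s)) : AddCircle ℓ →+ AddCircle L :=
  QuotientAddGroup.map _ _ (AddMonoidHom.mulRight s⁻¹) (by
    refine AddSubgroup.zmultiples_le_of_mem ?_
    rw [AddSubgroup.mem_comap, AddSubgroup.mem_zmultiples_iff]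
    refine ⟨n, ?_⟩
    have := hs.ne'
    simp only [AddMonoidHom.mulRight_apply, h, zsmul_eq_mul, Int.cast_natCast]
    field_simp)

lemma cover_coe (hs : 0 < s) (h : ℓ = n * (L * s)) (x : ℝ) :
    cover hs h (x : AddCircle ℓ) = ((x / s : ℝ) : AddCircle L) := by
  rw [div_eq_mul_inv]
  rfl

lemma continuous_cover (hs : 0 < s) (h : ℓ = n * (L * s)) : Continuous (cover hs h) := by
  refine continuous_coinduced_dom.mpr ?_
  have : (cover hs h ∘ fun x : ℝ => (x : AddCircle ℓ)) =
      fun x : ℝ => ((x / s : ℝ) : AddCircle L) := funext (cover_coe hs h)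
  change Continuous (cover hs h ∘ fun x : ℝ => (x : AddCircle ℓ))
  rw [this]
  exact (AddCircle.continuous_mk' L).comp (by fun_prop)

lemma surjective_cover (hs : 0 < s) (h : ℓ = n * (L * s)) :
    Function.Surjective (cover hs h) := fun y => by
  induction y using QuotientAddGroup.induction_on with
  | H y =>
    refine ⟨((y * s : ℝ) : AddCircle ℓ), ?_⟩
    rw [cover_coe, mul_div_cancel_right₀ _ hs.ne']

variable [hℓ : Fact (0 < ℓ)] [hL : Fact (0 < L)]

include hℓ hL in
lemma mul_scale_pos (h : ℓ = n * (L * s)) : 0 < n * s := by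
  have h1 := hℓ.out
  have h2 : ℓ = L * (n * s) := by rw [h]; ring
  rw [h2] at h1
  exact pos_of_mul_pos_right h1 hL.out.le

/-- A continuous surjective homomorphism of compact groups sends Haar measure to Haar measure, and
comparing total masses, `ℓ = (ns)L`, fixes the factor. -/
lemma measurePreserving_cover (hs : 0 < s) (h : ℓ = n * (L * s)) :
    MeasurePreserving (cover hs h) (volume : Measure (AddCircle ℓ))
      (ENNReal.ofReal (n * s) • (volume : Measure (AddCircle L))) := by
  have hpos := mul_scale_pos h
  have : (ENNReal.ofReal (n * s) • (volume : Measure (AddCircle L))).IsAddHaarMeasure :=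
    Measure.IsAddHaarMeasure.smul _ (ENNReal.ofReal_pos.2 hpos).ne' ENNReal.ofReal_ne_top
  refine AddMonoidHom.measurePreserving (continuous_cover hs h) (surjective_cover hs h) ?_
  rw [Measure.smul_apply, AddCircle.measure_univ, AddCircle.measure_univ, smul_eq_mul,
    ← ENNReal.ofReal_mul hpos.le, h]
  congr 1
  ring

lemma quasiMeasurePreserving_cover (hs : 0 < s) (h : ℓ = n * (L * s)) :
    Measure.QuasiMeasurePreserving (cover hs h) (volume : Measure (AddCircle ℓ))
      (volume : Measure (AddCircle L)) :=
  (measurePreserving_cover hs h).quasiMeasurePreserving.mono_right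
    (Measure.smul_absolutelyContinuous)

lemma memLp_comp_cover (hs : 0 < s) (h : ℓ = n * (L * s)) (f : L2 L) :
    MemLp (f ∘ cover hs h) 2 (volume : Measure (AddCircle ℓ)) :=
  ((Lp.memLp f).smul_measure ENNReal.ofReal_ne_top).comp_measurePreserving
    (measurePreserving_cover hs h)

/-- Composition of a square integrable function with the covering. -/
def pullFun (hs : 0 < s) (h : ℓ = n * (L * s)) (f : L2 L) : L2 ℓ :=
  (memLp_comp_cover hs h f).toLp (f ∘ cover hs h)

lemma coeFn_pullFun (hs : 0 < s) (h : ℓ = n * (L * s)) (f : L2 L) :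
    pullFun hs h f =ᵐ[volume] f ∘ cover hs h :=
  MemLp.coeFn_toLp (memLp_comp_cover hs h f)

lemma norm_pullFun (hs : 0 < s) (h : ℓ = n * (L * s)) (f : L2 L) :
    ‖pullFun hs h f‖ = √(n * s) * ‖f‖ := by
  have h1 := eLpNorm_comp_measurePreserving (p := 2)
    ((Lp.memLp f).smul_measure ENNReal.ofReal_ne_top).aestronglyMeasurable
    (measurePreserving_cover hs h)
  rw [pullFun, Lp.norm_toLp, h1, eLpNorm_smul_measure_of_ne_top (by norm_num), smul_eq_mul,
    ENNReal.toReal_mul, ← ENNReal.toReal_rpow, ENNReal.toReal_ofReal (mul_scale_pos h).le,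
    Lp.norm_def, Real.sqrt_eq_rpow]
  norm_num

/-- Composition with the covering, from `L²(ℝ/Lℤ)` to `L²(ℝ/ℓℤ)`. -/
def pull (hs : 0 < s) (h : ℓ = n * (L * s)) : L2 L →L[ℂ] L2 ℓ :=
  LinearMap.mkContinuous
    { toFun := pullFun hs h
      map_add' := fun f g => by
        apply Lp.ext
        filter_upwards [coeFn_pullFun hs h (f + g), coeFn_pullFun hs h f, coeFn_pullFun hs h g,
          (quasiMeasurePreserving_cover hs h).ae_eq_comp (Lp.coeFn_add f g),
          Lp.coeFn_add (pullFun hs h f) (pullFun hs h g)] with x h1 h2 h3 h4 h5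
        rw [h1, h4, h5, Pi.add_apply, h2, h3]
        rfl
      map_smul' := fun c f => by
        apply Lp.ext
        filter_upwards [coeFn_pullFun hs h (c • f), coeFn_pullFun hs h f,
          (quasiMeasurePreserving_cover hs h).ae_eq_comp (Lp.coeFn_smul c f),
          Lp.coeFn_smul c (pullFun hs h f)] with x h1 h2 h3 h4
        rw [h1, h3, RingHom.id_apply, h4, Pi.smul_apply, h2]
        rfl }
    (√(n * s)) (fun f => (norm_pullFun hs h f).le)

lemma coeFn_pull (hs : 0 < s) (h : ℓ = n * (L * s)) (f : L2 L) :
    pull hs h f =ᵐ[volume] f ∘ cover hs h :=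
  coeFn_pullFun hs h f

lemma norm_pull (hs : 0 < s) (h : ℓ = n * (L * s)) (f : L2 L) :
    ‖pull hs h f‖ = √(n * s) * ‖f‖ := norm_pullFun hs h f

section Periodize

variable {φ : ℝ → ℂ}

/-- The sum of a function of period `n L s` over the fibres of the covering. -/
def periodize (n : ℕ) (L s : ℝ) (φ : ℝ → ℂ) (y : ℝ) : ℂ :=
  ∑ j ∈ Finset.range n, φ (s * (y + j * L))

omit hℓ hL in
lemma hasDerivAt_periodize (hφ : Differentiable ℝ φ) (y : ℝ) :
    HasDerivAt (periodize n L s φ) (s * periodize n L s (deriv φ) y) y := by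
  unfold periodize
  rw [Finset.mul_sum]
  refine HasDerivAt.fun_sum fun j _ => ?_
  have h1 : HasDerivAt (fun y : ℝ => s * (y + j * L)) s y := by
    simpa using ((hasDerivAt_id y).add_const (j * L)).const_mul s
  have h2 := (hφ (s * (y + j * L))).hasDerivAt.scomp y h1
  simpa [Function.comp_def] using h2

omit hℓ hL in
lemma deriv_periodize (hφ : Differentiable ℝ φ) :
    deriv (periodize n L s φ) = fun y => s * periodize n L s (deriv φ) y :=
  funext fun y => (hasDerivAt_periodize hφ y).deriv

omit hℓ hL in
lemma IsTest.periodize (h : ℓ = n * (L * s)) (hφ : IsTest ℓ φ) :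
    IsTest L (periodize n L s φ) where
  smooth := by
    unfold SchrodingerEuler.periodize
    have := hφ.smooth
    fun_prop
  periodic := fun y => by
    have h1 := Finset.sum_range_succ (fun j : ℕ => φ (s * (y + j * L))) n
    have h2 := Finset.sum_range_succ' (fun j : ℕ => φ (s * (y + j * L))) n
    -- Translation by `L` permutes the fibre cyclically: the term `j = n` is the term `j = 0`
    -- shifted by the period `ℓ`.
    have h3 : φ (s * (y + n * L)) = φ (s * (y + (0 : ℕ) * L)) := by
      rw [show s * (y + n * L) = s * (y + (0 : ℕ) * L) + ℓ by rw [h]; push_cast; ring,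
        hφ.periodic]
    rw [h2, h3] at h1
    have h4 := add_right_cancel h1
    unfold SchrodingerEuler.periodize
    rw [← h4]
    refine Finset.sum_congr rfl fun j _ => ?_
    push_cast
    ring_nf

omit hℓ in
-- Unfolding: after `x = sy`, the interval `[0, nL]` is cut into `n` periods of `f`, over which the
-- test function is summed. Pulling back is thus dual to `periodize`, which preserves test
-- functions.
lemma pairing_comp_cover (hs : 0 < s) (h : ℓ = n * (L * s)) {f : AddCircle L → ℂ}
    (hf : Integrable f) (hφ : Continuous φ) :
    pairing (f ∘ cover hs h) φ = s * pairing f (periodize n L s φ) := by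
  have hfi : ∀ a b : ℝ, IntervalIntegrable (fun y : ℝ => f (y : AddCircle L)) volume a b := by
    refine Function.Periodic.intervalIntegrable₀ (T := L) (fun y => ?_) hL.out.ne' ?_
    · simp only [AddCircle.coe_add_period]
    · rw [intervalIntegrable_iff_integrableOn_Ioc_of_le hL.out.le]
      exact measurePreserving_coe.integrable_comp_of_integrable hf
  set H : ℝ → ℂ := fun y => f (y : AddCircle L) * φ (s * y) with hH
  have hHi : ∀ a b : ℝ, IntervalIntegrable H volume a b := fun a b =>
    (hfi a b).mul_continuousOn (by fun_prop)
  have h1 : pairing (f ∘ cover hs h) φ = ∫ x in (0 : ℝ)..ℓ, H (x / s) := by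
    unfold pairing
    congr 1
    ext x
    rw [hH, Function.comp_apply, cover_coe]
    simp only
    rw [mul_div_cancel₀ _ hs.ne']
  have h2 : ∀ j : ℕ, ∫ y in ((j : ℝ) * L)..((j + 1 : ℕ) : ℝ) * L, H y =
      ∫ y in (0 : ℝ)..L, f (y : AddCircle L) * φ (s * (y + j * L)) := fun j => by
    have h3 := intervalIntegral.integral_comp_add_right (a := 0) (b := L) H (j * L)
    rw [zero_add, show L + j * L = ((j + 1 : ℕ) : ℝ) * L by push_cast; ring] at h3
    rw [← h3]
    congr 1
    ext y
    have hp : Function.Periodic (fun y : ℝ => (y : AddCircle L)) L := AddCircle.coe_add_period L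
    have : ((y + j * L : ℝ) : AddCircle L) = (y : AddCircle L) := hp.nat_mul j y
    rw [hH]
    simp only [this]
  rw [h1, intervalIntegral.integral_comp_div _ hs.ne', zero_div, Complex.real_smul]
  congr 1
  have h4 := intervalIntegral.sum_integral_adjacent_intervals (f := H) (μ := volume)
    (a := fun j : ℕ => (j : ℝ) * L) (n := n) (fun j _ => hHi _ _)
  have h5 : ℓ / s = n * L := by
    rw [h]
    have := hs.ne'
    field_simp
  simp only [Nat.cast_zero, zero_mul] at h4
  rw [h5, ← h4]
  simp only [h2]
  rw [← intervalIntegral.integral_finsetSum fun j _ =>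
    (hfi 0 L).mul_continuousOn (by fun_prop)]
  simp only [pairing, periodize, Finset.mul_sum]

end Periodize

end Pullback

/-! ### Scaling of solutions and of initial data -/

section Rescaling

open ComplexConjugate Filter Topology

variable {ℓ L : ℝ} {s : ℝ} {n : ℕ} [hℓ : Fact (0 < ℓ)] [hL : Fact (0 < L)] {φ : ℝ → ℂ}

lemma pairing_pull (hs : 0 < s) (h : ℓ = n * (L * s)) (f : L2 L) (hφ : Continuous φ) :
    pairing (pull hs h f) φ = s * pairing f (periodize n L s φ) := by
  rw [pairing_congr (coeFn_pull hs h f),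
    pairing_comp_cover hs h ((Lp.memLp f).integrable (by norm_num)) hφ]

omit hℓ hL in
lemma pairing_deriv_periodize (f : AddCircle L → ℂ) (hφ : IsTest ℓ φ) :
    pairing f (deriv (periodize n L s φ)) = s * pairing f (periodize n L s (deriv φ)) := by
  rw [deriv_periodize (hφ.smooth.differentiable (by simp)), pairing_const_mul]

lemma hasWeakDeriv_pull (hs : 0 < s) (h : ℓ = n * (L * s)) (p : H1 L) :
    HasWeakDeriv (pull hs h (H1.fstL p)) ((s⁻¹ : ℂ) • pull hs h (H1.derivL p)) := by
  intro φ hφ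
  have hs' : (s : ℂ) ≠ 0 := by exact_mod_cast hs.ne'
  have hp : pairing (H1.derivL p) (periodize n L s φ) =
      -pairing (H1.fstL p) (deriv (periodize n L s φ)) := p.2 _ (hφ.periodize h)
  rw [pairing_smul, pairing_pull hs h _ hφ.smooth.continuous, pairing_pull hs h _
    hφ.continuous_deriv, hp, pairing_deriv_periodize _ hφ]
  field_simp

/-- Composition with the covering, from `H¹(ℝ/Lℤ)` to `H¹(ℝ/ℓℤ)`. -/
def pullH1 (hs : 0 < s) (h : ℓ = n * (L * s)) : H1 L →L[ℂ] H1 ℓ :=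
  ((WithLp.prodContinuousLinearEquiv 2 ℂ (L2 ℓ) (L2 ℓ)).symm.toContinuousLinearMap.comp
    (((pull hs h).comp H1.fstL).prod ((s⁻¹ : ℂ) • (pull hs h).comp H1.derivL))).codRestrict
      (H1 ℓ) (fun p => hasWeakDeriv_pull hs h p)

lemma fstL_pullH1 (hs : 0 < s) (h : ℓ = n * (L * s)) (p : H1 L) :
    H1.fstL (pullH1 hs h p) = pull hs h (H1.fstL p) := rfl

lemma pressure_pullH1_ae (hs : 0 < s) (h : ℓ = n * (L * s)) (p : H1 L) :
    (fun x => pressure (H1.toL2 (pullH1 hs h p) x)) =ᵐ[volume]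
      (fun x => pressure (H1.toL2 p x)) ∘ cover hs h := by
  filter_upwards [coeFn_pull hs h (H1.fstL p)] with x hx
  rw [H1.toL2_eq, fstL_pullH1, hx]
  rfl

lemma integrable_pressure (p : H1 L) : Integrable fun x => pressure (H1.toL2 p x) :=
  ((ContinuousMap.continuous _).integrable_of_hasCompactSupport
    (HasCompactSupport.of_compactSpace _)).congr (H1.pressure_ae p).symm

/-- The scaling `u(t, x) ↦ u(t / ε², x / ε²)` maps solutions of the system with dispersion `1/ε`
to solutions of the system with dispersion `ε`. -/
theorem IsSolution.pull {ε T : ℝ} (hε : 0 < ε) (h : ℓ = n * (L * ε ^ 2)) {u : ℝ → H1 L × L2 L}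
    (hu : IsSolution ε⁻¹ T u) :
    IsSolution ε (ε ^ 2 * T) (fun t => (pullH1 (pow_pos hε 2) h (u (t / ε ^ 2)).1,
      SchrodingerEuler.pull (pow_pos hε 2) h (u (t / ε ^ 2)).2)) := by
  have hs : 0 < ε ^ 2 := pow_pos hε 2
  have hε' : (ε : ℂ) ≠ 0 := by exact_mod_cast hε.ne'
  have hmaps : MapsTo (fun t : ℝ => t / ε ^ 2) (Icc 0 (ε ^ 2 * T)) (Icc 0 T) := fun t ht =>
    ⟨div_nonneg ht.1 hs.le, (div_le_iff₀' hs).2 ht.2⟩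
  have hd : ∀ t : ℝ, HasDerivWithinAt (fun t : ℝ => t / ε ^ 2) (1 / ε ^ 2)
      (Icc 0 (ε ^ 2 * T)) t := fun t => ((hasDerivAt_id t).div_const _).hasDerivWithinAt
  refine ⟨?_, fun φ hφ t ht => ?_, fun φ hφ t ht => ?_⟩
  · have hc := hu.continuousOn.comp (continuous_id.div_const (ε ^ 2)).continuousOn hmaps
    exact ((pullH1 hs h).continuous.comp_continuousOn hc.fst).prodMk
      ((SchrodingerEuler.pull hs h).continuous.comp_continuousOn hc.snd)
  · have h1 := HasDerivWithinAt.scomp t (hu.mass _ (hφ.periodize h) _ (hmaps ht)) (hd t) hmaps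
    -- This factor is the Jacobian in `pairing_pull`. The factor `1/ε²` from the time change is
    -- compensated by the `ε²` from differentiating the periodized test function.
    have h2 := h1.const_mul ((ε ^ 2 : ℝ) : ℂ)
    simp only [H1.toL2_eq, fstL_pullH1, pairing_pull hs h _ hφ.smooth.continuous,
      pairing_pull hs h _ hφ.continuous_deriv]
    refine h2.congr_deriv ?_
    rw [pairing_deriv_periodize _ hφ, Complex.real_smul]
    push_cast
    field_simp
  · have h1 := HasDerivWithinAt.scomp t (hu.momentum _ (hφ.periodize h) _ (hmaps ht)) (hd t) hmaps
    have h2 := h1.const_mul ((ε ^ 2 : ℝ) : ℂ)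
    have h3 : deriv (periodize n L (ε ^ 2) φ) =
        fun y => ((ε ^ 2 : ℝ) : ℂ) * periodize n L (ε ^ 2) (deriv φ) y :=
      deriv_periodize (hφ.smooth.differentiable (by simp))
    -- Two space derivatives give `ε⁴`; with `ε⁻²` from time, the dispersion `ε⁻¹` becomes `ε⁻¹ · ε²
    -- = ε`.
    have h4 : deriv (deriv (periodize n L (ε ^ 2) φ)) = fun y => ((ε ^ 2 : ℝ) : ℂ) *
        (((ε ^ 2 : ℝ) : ℂ) * periodize n L (ε ^ 2) (deriv (deriv φ)) y) := by
      rw [h3]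
      ext y
      exact ((hasDerivAt_periodize (hφ.deriv.smooth.differentiable (by simp)) y).const_mul _).deriv
    simp only [pairing_pull hs h _ hφ.smooth.continuous,
      pairing_pull hs h _ hφ.deriv.deriv.smooth.continuous]
    refine h2.congr_deriv ?_
    rw [pairing_congr (pressure_pullH1_ae hs h _), pairing_comp_cover hs h
      (integrable_pressure _) hφ.continuous_deriv, h4, h3, pairing_const_mul, pairing_const_mul,
      pairing_const_mul, Complex.real_smul]
    push_cast
    field_simp

/-- The line is a countable union of fundamental domains, on each of which the projection preserves
measure. -/
lemma ae_coe_of_ae {p : AddCircle ℓ → Prop} (hp : ∀ᵐ x : AddCircle ℓ, p x) :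
    ∀ᵐ x : ℝ, p (x : AddCircle ℓ) := by
  have h1 : ∀ k : ℤ, ∀ᵐ x : ℝ ∂(volume.restrict (Ioc (k • ℓ) ((k + 1) • ℓ))),
      p (x : AddCircle ℓ) := fun k => by
    have := (AddCircle.measurePreserving_mk ℓ (k • ℓ)).quasiMeasurePreserving.ae hp
    rwa [add_smul, one_smul]
  rw [← Measure.restrict_univ (μ := (volume : Measure ℝ)), ← iUnion_Ioc_zsmul hℓ.out,
    ae_restrict_iUnion_iff]
  exact h1

lemma L2_ext_of_ae_real {f g : L2 ℓ}
    (h : ∀ᵐ x : ℝ, f (x : AddCircle ℓ) = g (x : AddCircle ℓ)) : f = g := by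
  apply Lp.ext
  have hm : MeasurableSet {x : AddCircle ℓ | f x = g x} :=
    measurableSet_eq_fun (Lp.stronglyMeasurable f).measurable (Lp.stronglyMeasurable g).measurable
  have hmp := measurePreserving_coe (ℓ := ℓ)
  have h2 := (ae_map_iff hmp.aemeasurable hm).2 (ae_restrict_of_ae h)
  rwa [hmp.map_eq] at h2

lemma pull_ae_real (hs : 0 < s) (h : ℓ = n * (L * s)) (f : L2 L) :
    ∀ᵐ x : ℝ, pull hs h f (x : AddCircle ℓ) = f ((x / s : ℝ) : AddCircle L) := by
  filter_upwards [ae_coe_of_ae (coeFn_pull hs h f)] with x hx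
  rw [hx, Function.comp_apply, cover_coe]

lemma HasDatum.eq {ε : ℝ} {a : H1 (2 * π)} {b : L2 (2 * π)} {u v : ℝ → H1 ℓ × L2 ℓ}
    (hu : HasDatum ε a b u) (hv : HasDatum ε a b v) : u 0 = v 0 := by
  refine Prod.ext (H1.ext_coeff fun k => congrArg (coeff k) (L2_ext_of_ae_real ?_))
    (L2_ext_of_ae_real ?_)
  · filter_upwards [hu.1, hv.1] with x h1 h2
    exact h1.trans h2.symm
  · filter_upwards [hu.2, hv.2] with x h1 h2
    exact h1.trans h2.symm

lemma H1.ae_norm_le (p : H1 L) : ∀ᵐ x, ‖H1.fstL p x‖ ≤ ‖H1.toCont (ℓ := L)‖ * ‖p‖ := by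
  filter_upwards [H1.coeFn_toCont p] with x hx
  rw [hx]
  exact (ContinuousMap.norm_coe_le_norm _ _).trans (ContinuousLinearMap.le_opNorm _ _)

end Rescaling

end SchrodingerEuler

end

/-- The circle `ℝ/ℓℤ` ranges over all circles on which the datum `u⁰(x/ε²)` is well defined;
`ℓ = 2π` is the case of the torus `ℝ/2πℤ`, for `ε⁻²` an integer. -/
theorem theorem1 :
    ∃ T : ℝ, 0 < T ∧ ∃ C : ℝ, ∃ ε₀ : ℝ, 0 < ε₀ ∧
      ∀ ε : ℝ, 0 < ε → ε < ε₀ →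
      ∀ (ℓ : ℝ) [Fact (0 < ℓ)] (n : ℕ), ℓ = n * (2 * π * ε ^ 2) →
      ∀ (a : SchrodingerEuler.H1 (2 * π)) (b : SchrodingerEuler.L2 (2 * π)),
        (∫ x : AddCircle (2 * π), SchrodingerEuler.H1.toL2 a x) = 0 → (∫ x : AddCircle (2 * π), b x) = 0 →
        max ‖a‖ ‖b‖ < 1 / 6 →
        ∃ u : ℝ → SchrodingerEuler.H1 ℓ × SchrodingerEuler.L2 ℓ,
          SchrodingerEuler.IsSolution ε (ε ^ 2 * T) u ∧
          SchrodingerEuler.HasDatum ε a b u ∧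
          (∀ t ∈ Icc 0 (ε ^ 2 * T),
            (∀ᵐ x : AddCircle ℓ, ‖SchrodingerEuler.H1.toL2 (u t).1 x‖ ≤ C) ∧ ‖(u t).2‖ ≤ C * √ℓ) ∧
          (∀ v : ℝ → SchrodingerEuler.H1 ℓ × SchrodingerEuler.L2 ℓ,
            SchrodingerEuler.IsSolution ε (ε ^ 2 * T) v →
            SchrodingerEuler.HasDatum ε a b v → EqOn v u (Icc 0 (ε ^ 2 * T))) := by
  open SchrodingerEuler in
  obtain ⟨T, hT, C, hC⟩ := exists_isSolution (2 * π) (1 / 6)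
  set e := ‖H1.toCont (ℓ := 2 * π)‖
  -- The choice `ε₀ = 1` ensures `β = ε⁻¹ ≥ 1`. The constant `e` is the norm of the sup-norm
  -- embedding on the fixed circle `ℝ/2πℤ`, so it depends on neither `ε` nor `ℓ`; composition with
  -- the covering preserves essential bounds.
  refine ⟨T, hT, max (e * C) C, 1, one_pos, fun ε hε hε1 ℓ _ n hn a b _ _ hab => ?_⟩
  have hs : 0 < ε ^ 2 := pow_pos hε 2
  obtain ⟨hab1, hab2⟩ := max_lt_iff.1 hab
  obtain ⟨u, hu, hu0, hub⟩ := hC ε⁻¹ ((one_le_inv₀ hε).2 hε1.le) a b hab1.le hab2.le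
  have hsol := hu.pull hε hn
  have hdat : HasDatum ε a b (fun t => (pullH1 hs hn (u (t / ε ^ 2)).1,
      pull hs hn (u (t / ε ^ 2)).2)) := by
    simp only [HasDatum, zero_div, hu0]
    exact ⟨pull_ae_real hs hn _, pull_ae_real hs hn _⟩
  refine ⟨_, hsol, hdat, fun t _ => ⟨?_, ?_⟩, fun v hv hvd => hv.eqOn hε hsol (hvd.eq hdat)⟩
  · filter_upwards [coeFn_pull hs hn (H1.fstL (u (t / ε ^ 2)).1),
      (quasiMeasurePreserving_cover hs hn).ae (H1.ae_norm_le (u (t / ε ^ 2)).1)] with x hx hx'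
    rw [H1.toL2_eq, fstL_pullH1, hx]
    refine hx'.trans (le_trans ?_ (le_max_left _ _))
    exact mul_le_mul_of_nonneg_left (hub _).1
      (norm_nonneg (H1.toCont (ℓ := 2 * π)))
  · have hC0 : 0 ≤ C := (norm_nonneg _).trans (hub 0).1
    -- Pulling back multiplies the `L²` norm by `√(nε²)`, which is at most `√ℓ` because `ℓ = 2π ·
    -- nε²`.
    rw [norm_pull, mul_comm]
    refine mul_le_mul ((hub _).2.trans (le_max_right _ _)) (Real.sqrt_le_sqrt ?_)
      (Real.sqrt_nonneg _) (hC0.trans (le_max_right _ _))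
    rw [hn]
    have h1 : (1 : ℝ) ≤ 2 * π := by linarith [Real.two_le_pi]
    exact mul_le_mul_of_nonneg_left (le_mul_of_one_le_left hs.le h1) (Nat.cast_nonneg n)
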